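/- Let $M\ge 2$, and let $f_0,\dots,f_{M-1}$ be probability densities with respect to a common measure such that $0<\mathbf E_m[\log (f_m(X)/f_{m'}(X))]<\infty$ for all $m\neq m'$. Under $\mathbf P_m$ the raw data $X_1,X_2,\dots$ of a single sensor are i.i.d. with density $f_m$. For a deterministic quantizer, i.e. a measurable map $\phi$ from the raw data into a finite alphabet $\{0,\dots,l-1\}$ (binary if $l=2$), put $f_m(u;\phi)=\mathbf P_m(\phi(X)=u)$ and $$I(m,m';\phi)=\sum_{u} f_m(u;\phi)\log\frac{f_m(u;\phi)}{f_{m'}(u;\phi)} .$$ For a randomized quantizer $\bar\phi=\sum_j p^j\phi^j$, which uses the deterministic quantizer $\phi^j$ with probability $p^j$, put $I(m,m';\bar\phi)=\sum_j p^jI(m,m';\phi^j)$ and $I(m;\bar\phi)=\min_{m'\neq m}I(m,m';\bar\phi)$. Let $\pi=(\pi_0,\dots,\pi_{M-1})$ be a prior distribution, let $\phi^0$ be a deterministic quantizer with $I(m,m';\phi^0)>0$ for all $m\ne m'$, let $\bar\phi_0,\dots,\bar\phi_{M-1}$ be quantizers, and let $u(c)\in(0,1/2)$ satisfy $u(c)\to0$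 and $\log u(c)/\log c\to 0$ as $c\downarrow0$. The two-stage test $\delta(c)$ is defined as follows. The fusion center starts from $\pi_{m,0}=\pi_m$ and, when the message $U_n=\phi_{(n)}(X_n)$ arrives, updates $$\pi_{m,n}=\frac{\pi_{m,n-1}f_m(U_n;\phi_{(n)})}{\sum_{m'}\pi_{m',n-1}f_{m'}(U_n;\phi_{(n)})},$$ where $\phi_{(n)}$ is the deterministic quantizer used at time $n$, which the fusion center knows. In the first stage $\phi_{(n)}=\phi^0$; this stage ends at $N_0=\min\{n\ge0:\max_m\pi_{m,n}\ge1-u(c)\}$ with the preliminary decision $D_0=\arg\max_m\pi_{m,N_0}$. At each time $n>N_0$, $\phi_{(n)}$ is drawn according to the weights of the randomized quantizer $\bar\phi_{D_0}$, independently over time and of the raw data. The test stops at $N=\min\{n\ge N_0:\max_m\pi_{m,n}\ge1-c\}$ with the final decision $D=\arg\max_m\pi_{m,N}$. For losses with $W(m,m)=0$ and $W(m,m')>0$ for $m\ne m'$, its Bayes risk is $$\mathcal R_c(\delta(c))=\sum_m\pi_m\Big(c\,\mathbf E_mN+\sum_{m'}W(m,m')\mathbf P_m\{D=m'\}\Big).$$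 Theorem. Assume that each $\bar\phi_m$ is a randomization of finitely many deterministic quantizers, that $\pi_m>0$ for all $m$, and that $I(m;\bar\phi_{m'})>0$ for all $m,m'\in\{0,\dots,M-1\}$. Then, as $c\downarrow0$, for every $m$, $$\mathbf E_mN=(1+o(1))\,\frac{|\log c|}{I(m;\bar\phi_m)},\qquad \mathbf P_m\{D\ne m\}=O(c),$$ and consequently $$\mathcal R_c(\delta(c))=c|\log c|\,(1+o(1))\sum_{m=0}^{M-1}\frac{\pi_m}{I(m;\bar\phi_m)} .$$ In particular $\mathbf E_mN$ and the Bayes risk are finite for all small $c$. -/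

import Mathlib

open MeasureTheory Filter Topology Asymptotics
open scoped ENNReal

noncomputable section

namespace TwoStage

/-- The statistical model of the raw data of the sensor: under hypothesis `m` the raw data are
i.i.d. with density `f m` with respect to a common measure `μ`. -/
structure Model (𝒳 : Type*) [MeasurableSpace 𝒳] (M : ℕ) where
  μ : Measure 𝒳
  f : Fin M → 𝒳 → ℝ
  measurable_f : ∀ m, Measurable (f m)
  nonneg_f : ∀ m x, 0 ≤ f m x
  lintegral_f : ∀ m, ∫⁻ x, ENNReal.ofReal (f m x) ∂μ = 1

/-- A deterministic quantizer with message alphabet `{0, …, l - 1}`. -/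
structure Quantizer (𝒳 : Type*) [MeasurableSpace 𝒳] (l : ℕ) where
  toFun : 𝒳 → Fin l
  measurable_toFun : Measurable toFun

/-- A randomization of finitely many deterministic quantizers: the quantizer `quantizer j` is
used with probability `weight j`. -/
structure RandQuantizer (𝒳 : Type*) [MeasurableSpace 𝒳] (l : ℕ) where
  size : ℕ
  quantizer : Fin size → Quantizer 𝒳 l
  weight : PMF (Fin size)

/-- The ingredients of a two-stage test: the deterministic quantizer of the first stage, the
quantizer `second d` used in the second stage when the preliminary decision is `d`, and the
function `u` of the cost `c` that sets the first-stage threshold `1 - u c`. -/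
structure Design (𝒳 : Type*) [MeasurableSpace 𝒳] (M l : ℕ) where
  first : Quantizer 𝒳 l
  second : Fin M → RandQuantizer 𝒳 l
  u : ℝ → ℝ

variable {𝒳 : Type*} [MeasurableSpace 𝒳] {M l : ℕ}

/-- The law of one raw observation under hypothesis `m`. -/
def Model.law (S : Model 𝒳 M) (m : Fin M) : Measure 𝒳 :=
  S.μ.withDensity fun x => ENNReal.ofReal (S.f m x)

instance (S : Model 𝒳 M) (m : Fin M) : IsProbabilityMeasure (S.law m) :=
  ⟨by simpa [Model.law] using S.lintegral_f m⟩

/-- `0 < E_m [log (f_m / f_m')] < ∞` for all `m ≠ m'`. Finiteness of this extended-valued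
expectation includes that `f_m'` is positive `P_m`-almost surely (otherwise the integrand is
`+∞` with positive probability). -/
def Model.FiniteDivergence (S : Model 𝒳 M) : Prop :=
  ∀ m m' : Fin M, m ≠ m' →
    (∀ᵐ x ∂S.law m, 0 < S.f m' x) ∧
    Integrable (fun x => Real.log (S.f m x / S.f m' x)) (S.law m) ∧
    0 < ∫ x, Real.log (S.f m x / S.f m' x) ∂S.law m

/-- `f_m(u; φ) = P_m(φ(X) = u)`. -/
def Model.msgProb (S : Model 𝒳 M) (φ : Quantizer 𝒳 l) (m : Fin M) (v : Fin l) : ℝ :=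
  (S.law m).real (φ.toFun ⁻¹' {v})

/-- Kullback-Leibler divergence `I(m, m'; φ)` of a deterministic quantizer, with `0 log 0 = 0`.
(Under `FiniteDivergence` the laws are mutually absolutely continuous, so that the two message
probabilities vanish together.) -/
def Model.info (S : Model 𝒳 M) (φ : Quantizer 𝒳 l) (m m' : Fin M) : ℝ :=
  ∑ v, S.msgProb φ m v * Real.log (S.msgProb φ m v / S.msgProb φ m' v)

/-- `I(m, m'; φ̄) = ∑ p^j I(m, m'; φ^j)` for a randomized quantizer. -/
def Model.randInfo (S : Model 𝒳 M) (ψ : RandQuantizer 𝒳 l) (m m' : Fin M) : ℝ :=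
  ∑ j, (ψ.weight j).toReal * S.info (ψ.quantizer j) m m'

/-- `I(m; φ̄) = min_{m' ≠ m} I(m, m'; φ̄)`; the minimum of a finite set, nonempty for `M ≥ 2`. -/
def Model.minInfo (S : Model 𝒳 M) (ψ : RandQuantizer 𝒳 l) (m : Fin M) : ℝ :=
  ⨅ m' : {m' : Fin M // m' ≠ m}, S.randInfo ψ m m'.1

/-- Sample paths. At time `n + 1` the path shows the raw observation `X_{n+1} = (ω n).1` and,
for every possible preliminary decision `d`, the index `(ω n).2 d` of the deterministic quantizer
that the fusion center draws for time `n + 1` if it randomizes according to `second d`. -/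
abbrev Path (T : Design 𝒳 M l) : Type _ :=
  ℕ → 𝒳 × ((d : Fin M) → Fin (T.second d).size)

/-- The distribution of the sample path under hypothesis `m`: raw observations are i.i.d. with
density `f m`, and the randomization is i.i.d. in time and independent of the raw data. -/
def Model.pathMeasure (S : Model 𝒳 M) (T : Design 𝒳 M l) (m : Fin M) : Measure (Path T) :=
  Measure.infinitePi fun _ : ℕ =>
    (S.law m).prod (Measure.pi fun d => (T.second d).weight.toMeasure)

instance (S : Model 𝒳 M) (T : Design 𝒳 M l) (m : Fin M) :
    IsProbabilityMeasure (S.pathMeasure T m) := by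
  unfold Model.pathMeasure; infer_instance

/-- One step of Bayes' rule: from the posterior `p`, after the message that the quantizer `φ`
produces from the raw observation `x`. -/
def Model.update (S : Model 𝒳 M) (p : Fin M → ℝ) (φ : Quantizer 𝒳 l) (x : 𝒳) : Fin M → ℝ :=
  fun m => p m * S.msgProb φ m (φ.toFun x) / ∑ m', p m' * S.msgProb φ m' (φ.toFun x)

/-- The first time at which `A` holds; `⊤` if there is none. -/
def firstTime (A : ℕ → Prop) : ℕ∞ := ⨅ (n : ℕ) (_ : A n), (n : ℕ∞)

open Classical in
/-- The argmax of a vector (the smallest index that attains the maximum; there are no ties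
when the maximum of a probability vector exceeds `1 / 2`). -/
def argmax [NeZero M] (p : Fin M → ℝ) : Fin M :=
  (Finset.univ.filter fun m => ∀ m', p m' ≤ p m).min'
    (let ⟨m, hm⟩ := Finite.exists_max p; ⟨m, by simpa using hm⟩)

/-- The posterior distribution when only the first-stage quantizer is used. -/
def posterior₁ (S : Model 𝒳 M) (T : Design 𝒳 M l) (prior : Fin M → ℝ) (ω : Path T) :
    ℕ → Fin M → ℝ
  | 0 => prior
  | n + 1 => S.update (posterior₁ S T prior ω n) T.first (ω n).1

/-- `N₀ = min {n ≥ 0 : max_m π_{m,n} ≥ 1 - u(c)}`. -/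
def N₀ (S : Model 𝒳 M) (T : Design 𝒳 M l) (prior : Fin M → ℝ) (c : ℝ) (ω : Path T) : ℕ∞ :=
  firstTime fun n => ∃ m, 1 - T.u c ≤ posterior₁ S T prior ω n m

/-- The preliminary decision (immaterial on the null event `N₀ = ⊤`). -/
def D₀ [NeZero M] (S : Model 𝒳 M) (T : Design 𝒳 M l) (prior : Fin M → ℝ) (c : ℝ) (ω : Path T) :
    Fin M :=
  argmax (posterior₁ S T prior ω (N₀ S T prior c ω).toNat)

open Classical in
/-- The deterministic quantizer used at time `n + 1`: that of the first stage if `n + 1 ≤ N₀`,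
and the one drawn from `second D₀` later on. -/
def usedQuantizer [NeZero M] (S : Model 𝒳 M) (T : Design 𝒳 M l) (prior : Fin M → ℝ) (c : ℝ)
    (ω : Path T) (n : ℕ) : Quantizer 𝒳 l :=
  if ((n + 1 : ℕ) : ℕ∞) ≤ N₀ S T prior c ω then T.first
  else (T.second (D₀ S T prior c ω)).quantizer ((ω n).2 (D₀ S T prior c ω))

/-- The posterior distribution `π_{m,n}` at the fusion center, updated throughout both stages;
the fusion center knows which deterministic quantizer is used at each time. -/
def posterior [NeZero M] (S : Model 𝒳 M) (T : Design 𝒳 M l) (prior : Fin M → ℝ) (c : ℝ)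
    (ω : Path T) : ℕ → Fin M → ℝ
  | 0 => prior
  | n + 1 => S.update (posterior S T prior c ω n) (usedQuantizer S T prior c ω n) (ω n).1

/-- `N = min {n ≥ N₀ : max_m π_{m,n} ≥ 1 - c}`. -/
def N [NeZero M] (S : Model 𝒳 M) (T : Design 𝒳 M l) (prior : Fin M → ℝ) (c : ℝ) (ω : Path T) :
    ℕ∞ :=
  firstTime fun n => N₀ S T prior c ω ≤ (n : ℕ∞) ∧ ∃ m, 1 - c ≤ posterior S T prior c ω n m

/-- The final decision (immaterial on the null event `N = ⊤`). -/
def D [NeZero M] (S : Model 𝒳 M) (T : Design 𝒳 M l) (prior : Fin M → ℝ) (c : ℝ) (ω : Path T) :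
    Fin M :=
  argmax (posterior S T prior c ω (N S T prior c ω).toNat)

/-- `E_m N`, possibly infinite. -/
def expN [NeZero M] (S : Model 𝒳 M) (T : Design 𝒳 M l) (prior : Fin M → ℝ) (c : ℝ) (m : Fin M) :
    ℝ≥0∞ :=
  ∫⁻ ω, (N S T prior c ω : ℝ≥0∞) ∂S.pathMeasure T m

/-- The Bayes risk `∑_m π_m (c E_m N + ∑_{m'} W(m, m') P_m(D = m'))`, possibly infinite. -/
def bayesRisk [NeZero M] (S : Model 𝒳 M) (T : Design 𝒳 M l) (prior : Fin M → ℝ)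
    (W : Fin M → Fin M → ℝ) (c : ℝ) : ℝ≥0∞ :=
  ∑ m, ENNReal.ofReal (prior m) *
    (ENNReal.ofReal c * expN S T prior c m +
      ∑ m', ENNReal.ofReal (W m m') * S.pathMeasure T m {ω | D S T prior c ω = m'})

/-- The requirements on the design of the first stage: `φ⁰` distinguishes all hypotheses, and
`u(c) ∈ (0, 1/2)`, `u(c) → 0`, `log u(c) / log c → 0` as `c → 0`. -/
structure ValidFirstStage (S : Model 𝒳 M) (T : Design 𝒳 M l) : Prop where
  info_pos : ∀ m m' : Fin M, m ≠ m' → 0 < S.info T.first m m'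
  u_mem : ∀ᶠ c in 𝓝[>] (0 : ℝ), T.u c ∈ Set.Ioo (0 : ℝ) (1 / 2)
  u_tendsto : Tendsto T.u (𝓝[>] 0) (𝓝 0)
  log_u : Tendsto (fun c => Real.log (T.u c) / Real.log c) (𝓝[>] 0) (𝓝 0)

end TwoStage

end

noncomputable section

namespace TwoStage

open ProbabilityTheory

section Adapted

variable {E : Type*} [MeasurableSpace E] {ν : Measure E} [IsProbabilityMeasure ν]

theorem measurable_update_pair (n : ℕ) :
    Measurable fun p : (ℕ → E) × E => Function.update p.1 n p.2 := by
  refine measurable_pi_lambda _ fun i => ?_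
  by_cases h : i = n
  · subst h; simpa using measurable_snd
  · simpa [Function.update_of_ne h] using measurable_fst.eval (a := i)

/-- Resampling one coordinate of an i.i.d. sequence does not change its distribution. -/
theorem map_update_infinitePi (n : ℕ) :
    ((Measure.infinitePi fun _ : ℕ => ν).prod ν).map
      (fun p => Function.update p.1 n p.2) = Measure.infinitePi fun _ : ℕ => ν := by
  classical
  refine Measure.eq_infinitePi _ fun s t ht => ?_
  rw [Measure.map_apply (measurable_update_pair n)
    (MeasurableSet.pi s.countable_toSet fun i _ => ht i)]
  by_cases hn : n ∈ s
  · have : (fun p : (ℕ → E) × E => Function.update p.1 n p.2) ⁻¹' (s : Set ℕ).pi t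
        = ((s.erase n : Finset ℕ) : Set ℕ).pi t ×ˢ t n := by
      ext ⟨ω, x⟩
      simp only [Set.mem_preimage, Set.mem_pi, Finset.mem_coe, Set.mem_prod, Finset.mem_erase]
      constructor
      · intro h
        exact ⟨fun i hi => by simpa [Function.update_of_ne hi.1] using h i hi.2,
          by simpa using h n hn⟩
      · rintro ⟨h, hx⟩ i hi
        by_cases hin : i = n
        · subst hin; simpa using hx
        · simpa [Function.update_of_ne hin] using h i ⟨hin, hi⟩
    rw [this, Measure.prod_prod, Measure.infinitePi_pi _ fun i _ => ht i,
      Finset.prod_erase_mul s (fun i => ν (t i)) hn]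
  · have : (fun p : (ℕ → E) × E => Function.update p.1 n p.2) ⁻¹' (s : Set ℕ).pi t
        = (s : Set ℕ).pi t ×ˢ Set.univ := by
      ext ⟨ω, x⟩
      simp only [Set.mem_preimage, Set.mem_pi, Finset.mem_coe, Set.mem_prod, Set.mem_univ,
        and_true]
      refine forall₂_congr fun i hi => ?_
      rw [Function.update_of_ne (ne_of_mem_of_not_mem hi hn)]
    rw [this, Measure.prod_prod, Measure.infinitePi_pi _ fun i _ => ht i, measure_univ, mul_one]

theorem update_eq_of_dependsOn {E α : Type*} {F : (ℕ → E) → α} {n : ℕ}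
    (hF : DependsOn F (Set.Iio n)) (ω : ℕ → E) (x : E) : F (Function.update ω n x) = F ω :=
  hF fun _ hi => Function.update_of_ne (ne_of_lt hi) _ _

theorem lintegral_mul_le_of_lintegral_update_le {F G : (ℕ → E) → ℝ≥0∞} {n : ℕ} {K : ℝ≥0∞}
    (hF : Measurable F) (hFn : DependsOn F (Set.Iio n)) (hG : Measurable G)
    (hK : ∀ ω, ∫⁻ x, G (Function.update ω n x) ∂ν ≤ K) :
    ∫⁻ ω, F ω * G ω ∂(Measure.infinitePi fun _ : ℕ => ν)
      ≤ K * ∫⁻ ω, F ω ∂(Measure.infinitePi fun _ : ℕ => ν) := by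
  have hm := measurable_update_pair (E := E) n
  have hFG : Measurable fun ω => F ω * G ω := hF.mul hG
  calc ∫⁻ ω, F ω * G ω ∂(Measure.infinitePi fun _ : ℕ => ν)
      = ∫⁻ p, F (Function.update p.1 n p.2) * G (Function.update p.1 n p.2)
          ∂((Measure.infinitePi fun _ : ℕ => ν).prod ν) := by
        conv_lhs => rw [← map_update_infinitePi (ν := ν) n]
        rw [lintegral_map hFG hm]
    _ = ∫⁻ ω, ∫⁻ x, F ω * G (Function.update ω n x) ∂ν
          ∂(Measure.infinitePi fun _ : ℕ => ν) := by
        rw [lintegral_prod (fun p : (ℕ → E) × E => F (Function.update p.1 n p.2) *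
          G (Function.update p.1 n p.2)) (hFG.comp hm).aemeasurable]
        simp_rw [update_eq_of_dependsOn hFn]
    _ ≤ ∫⁻ ω, F ω * K ∂(Measure.infinitePi fun _ : ℕ => ν) := by
        refine lintegral_mono fun ω => ?_
        have hGu : Measurable fun x => G (Function.update ω n x) :=
          hG.comp (hm.comp measurable_prodMk_left)
        rw [lintegral_const_mul _ hGu]
        gcongr
        exact hK ω
    _ = K * ∫⁻ ω, F ω ∂(Measure.infinitePi fun _ : ℕ => ν) := by
        rw [lintegral_mul_const _ hF, mul_comm]

theorem lintegral_prod_range_le {G : ℕ → (ℕ → E) → ℝ≥0∞} {K : ℝ≥0∞}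
    (hG : ∀ n, Measurable (G n)) (hGn : ∀ n, DependsOn (G n) (Set.Iio (n + 1)))
    (hK : ∀ n ω, ∫⁻ x, G n (Function.update ω n x) ∂ν ≤ K) (n : ℕ) :
    ∫⁻ ω, ∏ k ∈ Finset.range n, G k ω ∂(Measure.infinitePi fun _ : ℕ => ν) ≤ K ^ n := by
  induction n with
  | zero => simp
  | succ n ih =>
    simp_rw [Finset.prod_range_succ]
    refine (lintegral_mul_le_of_lintegral_update_le (n := n)
      (Finset.measurable_prod _ fun k _ => hG k) ?_ (hG n) (hK n)).trans ?_
    · intro ω ω' h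
      refine Finset.prod_congr rfl fun k hk => hGn k fun i hi => h i ?_
      simp only [Set.mem_Iio, Finset.mem_range] at *
      omega
    · rw [pow_succ, mul_comm]
      gcongr

theorem prod_ofReal_exp (Y : ℕ → ℝ) (n : ℕ) :
    ∏ k ∈ Finset.range n, ENNReal.ofReal (Real.exp (Y k))
      = ENNReal.ofReal (Real.exp (∑ k ∈ Finset.range n, Y k)) := by
  rw [Real.exp_sum, ENNReal.ofReal_prod_of_nonneg fun _ _ => (Real.exp_pos _).le]

/-- Chernoff bound for adapted increments with conditionally sub-Gaussian laws. -/
theorem measure_sum_ge_le_exp {Y : ℕ → (ℕ → E) → ℝ} {K : ℝ} (hK : 0 < K)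
    (hY : ∀ n, Measurable (Y n)) (hYn : ∀ n, DependsOn (Y n) (Set.Iio (n + 1)))
    (hmgf : ∀ n ω (r : ℝ), ∫⁻ x, ENNReal.ofReal (Real.exp (r * Y n (Function.update ω n x))) ∂ν
      ≤ ENNReal.ofReal (Real.exp (K * r ^ 2)))
    {n : ℕ} {a t : ℝ} (ha : 0 < a) (hna : (n : ℝ) ≤ a) (ht : 0 ≤ t) :
    (Measure.infinitePi fun _ : ℕ => ν) {ω | t ≤ ∑ k ∈ Finset.range n, Y k ω}
      ≤ ENNReal.ofReal (Real.exp (-(t ^ 2 / (4 * K * a)))) := by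
  set r : ℝ := t / (2 * K * a) with hr
  have hr0 : 0 ≤ r := by positivity
  have hE : ∫⁻ ω, ENNReal.ofReal (Real.exp (∑ k ∈ Finset.range n, r * Y k ω))
      ∂(Measure.infinitePi fun _ : ℕ => ν) ≤ ENNReal.ofReal (Real.exp (n * (K * r ^ 2))) := by
    have h := lintegral_prod_range_le (ν := ν)
      (G := fun k ω => ENNReal.ofReal (Real.exp (r * Y k ω)))
      (K := ENNReal.ofReal (Real.exp (K * r ^ 2)))
      (fun k => by have := hY k; fun_prop)
      (fun k ω ω' h => by simp only [hYn k h]) (fun k ω => hmgf k ω r) n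
    simp_rw [prod_ofReal_exp] at h
    refine h.trans_eq ?_
    rw [← ENNReal.ofReal_pow (Real.exp_pos _).le, ← Real.exp_nat_mul]
  have hmeas : Measurable fun ω => ENNReal.ofReal (Real.exp (∑ k ∈ Finset.range n, r * Y k ω)) := by
    fun_prop
  calc (Measure.infinitePi fun _ : ℕ => ν) {ω | t ≤ ∑ k ∈ Finset.range n, Y k ω}
      ≤ (Measure.infinitePi fun _ : ℕ => ν) {ω | ENNReal.ofReal (Real.exp (r * t)) ≤
          ENNReal.ofReal (Real.exp (∑ k ∈ Finset.range n, r * Y k ω))} := by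
        refine measure_mono fun ω hω => ?_
        simp only [Set.mem_ofPred_eq, ← Finset.mul_sum] at *
        exact ENNReal.ofReal_le_ofReal (Real.exp_le_exp.2 (mul_le_mul_of_nonneg_left hω hr0))
    _ ≤ ENNReal.ofReal (Real.exp (n * (K * r ^ 2))) / ENNReal.ofReal (Real.exp (r * t)) := by
        refine (meas_ge_le_lintegral_div hmeas.aemeasurable ?_ ENNReal.ofReal_ne_top).trans ?_
        · simpa using Real.exp_pos _
        · gcongr
    _ = ENNReal.ofReal (Real.exp (n * (K * r ^ 2) - r * t)) := by
        rw [← ENNReal.ofReal_div_of_pos (Real.exp_pos _), Real.exp_sub]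
    _ ≤ _ := by
        refine ENNReal.ofReal_le_ofReal (Real.exp_le_exp.2 ?_)
        have h1 : n * (K * r ^ 2) ≤ a * (K * r ^ 2) := by gcongr
        have h2 : a * (K * r ^ 2) - r * t = -(t ^ 2 / (4 * K * a)) := by
          rw [hr]; field_simp; ring
        linarith

/-- Ville's inequality for the exponential of a sum of adapted increments. -/
theorem measure_exists_sum_le_neg_le_exp {Y : ℕ → (ℕ → E) → ℝ}
    (hY : ∀ n, Measurable (Y n)) (hYn : ∀ n, DependsOn (Y n) (Set.Iio (n + 1)))
    (hexp : ∀ n ω, ∫⁻ x, ENNReal.ofReal (Real.exp (-Y n (Function.update ω n x))) ∂ν ≤ 1)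
    (t : ℝ) :
    (Measure.infinitePi fun _ : ℕ => ν) {ω | ∃ n, ∑ k ∈ Finset.range n, Y k ω ≤ -t}
      ≤ ENNReal.ofReal (Real.exp (-t)) := by
  classical
  set P := Measure.infinitePi fun _ : ℕ => ν
  rcases lt_or_ge t 0 with ht | ht
  · refine prob_le_one.trans ?_
    rw [← ENNReal.ofReal_one]
    exact ENNReal.ofReal_le_ofReal (Real.one_le_exp (by linarith))
  let S : ℕ → (ℕ → E) → ℝ := fun n ω => ∑ k ∈ Finset.range n, Y k ω
  let A : ℕ → Set (ℕ → E) := fun n => {ω | ∃ j ≤ n, S j ω ≤ -t}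
  let R : ℕ → (ℕ → E) → ℝ≥0∞ := fun n ω => ENNReal.ofReal (Real.exp (-S n ω))
  have hS : ∀ n, Measurable (S n) := fun n => by fun_prop
  have hSn : ∀ n, DependsOn (S n) (Set.Iio n) := fun n ω ω' h =>
    Finset.sum_congr rfl fun k hk => hYn k fun i hi => h i (by
      simp only [Set.mem_Iio, Finset.mem_range] at *; omega)
  have hR : ∀ n, Measurable (R n) := fun n => by fun_prop
  have hA : ∀ n, MeasurableSet (A n) := fun n => by
    have : A n = ⋃ j ∈ Finset.range (n + 1), {ω | S j ω ≤ -t} := by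
      ext ω; simp [A]
    rw [this]
    exact Finset.measurableSet_biUnion _ fun j _ => measurableSet_le (hS j) measurable_const
  have hAn : ∀ n, DependsOn (fun ω => ω ∈ A n) (Set.Iio n) := fun n ω ω' h => by
    have h' : ∀ j ≤ n, S j ω = S j ω' := fun j hj => hSn j fun i hi => h i (lt_of_lt_of_le hi hj)
    simp only [A, Set.mem_ofPred_eq, eq_iff_iff]
    exact exists_congr fun j => and_congr_right fun hj => by rw [h' j hj]
  have key : ∀ n, ∫⁻ ω, (A n)ᶜ.indicator (R n) ω ∂P + ENNReal.ofReal (Real.exp t) * P (A n) ≤ 1 := by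
    intro n
    induction n with
    | zero =>
      rcases ht.eq_or_lt with ht0 | ht0
      · have : A 0 = Set.univ := by ext ω; simp [A, S, ← ht0]
        simp [this, ← ht0]
      · have : A 0 = ∅ := by ext ω; simp [A, S, ht0]
        simp [this, R, S]
    | succ n ih =>
      have hsub : A n ⊆ A (n + 1) := fun ω ⟨j, hj, h⟩ => ⟨j, by omega, h⟩
      have hstep : ∫⁻ ω, (A n)ᶜ.indicator (R (n + 1)) ω ∂P
          ≤ ∫⁻ ω, (A n)ᶜ.indicator (R n) ω ∂P := by
        have h := lintegral_mul_le_of_lintegral_update_le (ν := ν) (n := n)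
          (F := (A n)ᶜ.indicator (R n)) (G := fun ω => ENNReal.ofReal (Real.exp (-Y n ω))) (K := 1)
          ((hR n).indicator (hA n).compl) ?_ (by have := hY n; fun_prop) (hexp n)
        · rw [one_mul] at h
          refine le_trans (le_of_eq (lintegral_congr fun ω => ?_)) h
          by_cases hω : ω ∈ A n
          · simp [hω]
          · simp only [Set.indicator_of_mem (Set.mem_compl hω), R, S]
            rw [Finset.sum_range_succ, neg_add, Real.exp_add,
              ENNReal.ofReal_mul (Real.exp_pos _).le]
        · intro ω ω' h
          have h1 : ω ∈ A n ↔ ω' ∈ A n := by simpa using hAn n h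
          have h2 : R n ω = R n ω' := by simp only [R, hSn n h]
          by_cases hω : ω ∈ A n
          · simp [hω, h1.1 hω]
          · simp [hω, mt h1.2 hω, h2]
      have hsplit : ∫⁻ ω, (A (n + 1))ᶜ.indicator (R (n + 1)) ω ∂P
            + ENNReal.ofReal (Real.exp t) * P (A (n + 1) \ A n)
          ≤ ∫⁻ ω, (A n)ᶜ.indicator (R (n + 1)) ω ∂P := by
        rw [← lintegral_indicator_const ((hA _).diff (hA _)),
          ← lintegral_add_left ((hR _).indicator (hA _).compl)]
        refine lintegral_mono fun ω => ?_
        by_cases h1 : ω ∈ A n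
        · simp [h1, hsub h1]
        · by_cases h2 : ω ∈ A (n + 1)
          · simp only [Set.mem_compl_iff, h1, not_false_eq_true, Set.indicator_of_mem, h2,
              not_true_eq_false, Set.indicator_of_notMem, zero_add, Set.mem_sdiff, and_self]
            obtain ⟨j, hj, hle⟩ := h2
            have hj' : j = n + 1 := by
              by_contra hne
              exact h1 ⟨j, by omega, hle⟩
            subst hj'
            exact ENNReal.ofReal_le_ofReal (Real.exp_le_exp.2 (by linarith))
          · simp [h1, h2]
      have hPA : P (A (n + 1)) = P (A (n + 1) \ A n) + P (A n) := by
        rw [← measure_sdiff_add_inter _ (hA n), Set.inter_eq_right.2 hsub]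
      rw [hPA, mul_add, ← add_assoc]
      exact le_trans (by gcongr; exact hsplit.trans hstep) ih
  have hunion : {ω | ∃ n, ∑ k ∈ Finset.range n, Y k ω ≤ -t} = ⋃ n, A n := by
    ext ω
    simp only [Set.mem_ofPred_eq, Set.mem_iUnion, A, S]
    exact ⟨fun ⟨n, h⟩ => ⟨n, n, le_rfl, h⟩, fun ⟨_, j, _, h⟩ => ⟨j, h⟩⟩
  have hmono : Monotone A := fun i j hij ω ⟨k, hk, h⟩ => ⟨k, hk.trans hij, h⟩
  rw [hunion, hmono.measure_iUnion]
  refine iSup_le fun n => ?_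
  have h := (le_add_left le_rfl).trans (key n)
  rw [Real.exp_neg, ENNReal.ofReal_inv_of_pos (Real.exp_pos _), ← one_div,
    ENNReal.le_div_iff_mul_le (by simp [Real.exp_pos]) (by simp), mul_comm]
  exact h

end Adapted

end TwoStage

end

noncomputable section

namespace TwoStage

open ProbabilityTheory

variable {𝒳 : Type*} [MeasurableSpace 𝒳] {M l : ℕ}

/-- What the path shows at one time: the raw observation and the drawn quantizer indices. -/
abbrev Coord (T : Design 𝒳 M l) : Type _ := 𝒳 × ((d : Fin M) → Fin (T.second d).size)

/-- The quantizer in use: that of the first stage for `none`, the one drawn from `second d` for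
`some d`. -/
def Design.quant (T : Design 𝒳 M l) (s : Option (Fin M))
    (i : (d : Fin M) → Fin (T.second d).size) : Quantizer 𝒳 l :=
  match s with
  | none => T.first
  | some d => (T.second d).quantizer (i d)

def Design.msg (T : Design 𝒳 M l) (s : Option (Fin M)) (e : Coord T) : Fin l :=
  (T.quant s e.2).toFun e.1

/-- The log-likelihood ratio of one message. -/
def Quantizer.llr (φ : Quantizer 𝒳 l) (S : Model 𝒳 M) (m m' : Fin M) (v : Fin l) : ℝ :=
  Real.log (S.msgProb φ m v / S.msgProb φ m' v)

def Model.llr (S : Model 𝒳 M) (T : Design 𝒳 M l) (m m' : Fin M) (s : Option (Fin M))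
    (e : Coord T) : ℝ :=
  (T.quant s e.2).llr S m m' (T.msg s e)

/-- The mean of `Model.llr` under hypothesis `m`. -/
def Model.drift (S : Model 𝒳 M) (T : Design 𝒳 M l) (m m' : Fin M) : Option (Fin M) → ℝ
  | none => S.info T.first m m'
  | some d => S.randInfo (T.second d) m m'

def Model.coordMeasure (S : Model 𝒳 M) (T : Design 𝒳 M l) (m : Fin M) : Measure (Coord T) :=
  (S.law m).prod (Measure.pi fun d => (T.second d).weight.toMeasure)

instance (S : Model 𝒳 M) (T : Design 𝒳 M l) (m : Fin M) :
    IsProbabilityMeasure (S.coordMeasure T m) := by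
  unfold Model.coordMeasure; infer_instance

theorem Model.law_absolutelyContinuous {S : Model 𝒳 M} (hS : S.FiniteDivergence) (m m' : Fin M) :
    S.law m ≪ S.law m' := by
  rcases eq_or_ne m m' with rfl | hne
  · exact Measure.AbsolutelyContinuous.rfl
  intro A hA
  have hf : Measurable fun x => ENNReal.ofReal (S.f m' x) := (S.measurable_f m').ennreal_ofReal
  rw [Model.law, withDensity_apply_eq_zero hf] at hA
  have h1 := withDensity_absolutelyContinuous S.μ (fun x => ENNReal.ofReal (S.f m x)) hA
  have h2 := (hS m m' hne).1
  rw [ae_iff] at h2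
  refine measure_mono_null (fun x hx => ?_) (measure_union_null h1 h2)
  by_cases h : 0 < S.f m' x
  · exact Or.inl ⟨by simpa using h, hx⟩
  · exact Or.inr h

theorem Model.msgProb_eq_zero {S : Model 𝒳 M} (hS : S.FiniteDivergence) {φ : Quantizer 𝒳 l}
    {m' : Fin M} {v : Fin l} (h : S.msgProb φ m' v = 0) (m : Fin M) : S.msgProb φ m v = 0 := by
  rw [Model.msgProb, measureReal_eq_zero_iff] at *
  exact Model.law_absolutelyContinuous hS m m' h

theorem Model.sum_msgProb (S : Model 𝒳 M) (φ : Quantizer 𝒳 l) (m : Fin M) :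
    ∑ v, S.msgProb φ m v = 1 := by
  have h := sum_measureReal_preimage_singleton (μ := S.law m) (f := φ.toFun) Finset.univ
    fun v _ => φ.measurable_toFun (measurableSet_singleton v)
  simp only [Model.msgProb]
  rw [h]; simp

theorem Quantizer.integral_comp (φ : Quantizer 𝒳 l) (S : Model 𝒳 M) (m : Fin M) (g : Fin l → ℝ) :
    ∫ x, g (φ.toFun x) ∂S.law m = ∑ v, S.msgProb φ m v * g v := by
  have hp : IsProbabilityMeasure ((S.law m).map φ.toFun) :=
    Measure.isProbabilityMeasure_map φ.measurable_toFun.aemeasurable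
  rw [← integral_map (f := g) φ.measurable_toFun.aemeasurable
    (Measurable.of_discrete).aestronglyMeasurable, integral_fintype Integrable.of_finite]
  refine Finset.sum_congr rfl fun v _ => ?_
  rw [map_measureReal_apply φ.measurable_toFun (measurableSet_singleton v), smul_eq_mul]
  rfl

theorem Design.measurable_comp_index (T : Design 𝒳 M l) {α : Type*} [MeasurableSpace α]
    {F : Coord T → α} (hF : ∀ i, Measurable fun x => F (x, i)) : Measurable F :=
  measurable_from_prod_countable_left hF

theorem Design.measurable_msg (T : Design 𝒳 M l) (s : Option (Fin M)) : Measurable (T.msg s) :=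
  T.measurable_comp_index fun i => (T.quant s i).measurable_toFun

theorem Design.measurable_comp_msg (T : Design 𝒳 M l) (s : Option (Fin M)) {α : Type*}
    [MeasurableSpace α] (g : Quantizer 𝒳 l → Fin l → α) :
    Measurable fun e : Coord T => g (T.quant s e.2) (T.msg s e) :=
  T.measurable_comp_index fun i =>
    (Measurable.of_discrete (f := g (T.quant s i))).comp (T.quant s i).measurable_toFun

theorem exists_bound_quant (T : Design 𝒳 M l) (g : Fin M → Quantizer 𝒳 l → Fin l → ℝ) :
    ∃ B : ℝ, 0 < B ∧ ∀ m' s i v, |g m' (T.quant s i) v| ≤ B := by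
  obtain ⟨B, hB⟩ := (Set.finite_range fun p : Fin M × Option (Fin M) ×
    ((d : Fin M) → Fin (T.second d).size) × Fin l =>
      |g p.1 (T.quant p.2.1 p.2.2.1) p.2.2.2|).bddAbove
  exact ⟨max B 1, by positivity, fun m' s i v =>
    (hB ⟨(m', s, i, v), rfl⟩).trans (le_max_left _ _)⟩

theorem integrable_comp_msg (S : Model 𝒳 M) (T : Design 𝒳 M l) (m : Fin M) (s : Option (Fin M))
    (g : Quantizer 𝒳 l → Fin l → ℝ) :
    Integrable (fun e => g (T.quant s e.2) (T.msg s e)) (S.coordMeasure T m) := by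
  obtain ⟨B, -, hB⟩ := exists_bound_quant T fun _ => g
  exact Integrable.of_bound (T.measurable_comp_msg s g).aestronglyMeasurable B
    (ae_of_all _ fun e => hB m s e.2 _)

theorem integral_comp_msg_none (S : Model 𝒳 M) (T : Design 𝒳 M l) (m : Fin M)
    (g : Quantizer 𝒳 l → Fin l → ℝ) :
    ∫ e, g (T.quant none e.2) (T.msg none e) ∂S.coordMeasure T m
      = ∑ v, S.msgProb T.first m v * g T.first v := by
  rw [← Quantizer.integral_comp]
  simpa [Model.coordMeasure, Design.quant, Design.msg] using
    integral_fun_fst (μ := S.law m)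
      (ν := Measure.pi fun d => (T.second d).weight.toMeasure) fun x => g T.first (T.first.toFun x)

theorem integral_comp_msg_some (S : Model 𝒳 M) (T : Design 𝒳 M l) (m : Fin M) (d : Fin M)
    (g : Quantizer 𝒳 l → Fin l → ℝ) :
    ∫ e, g (T.quant (some d) e.2) (T.msg (some d) e) ∂S.coordMeasure T m
      = ∑ j, ((T.second d).weight j).toReal *
          ∑ v, S.msgProb ((T.second d).quantizer j) m v * g ((T.second d).quantizer j) v := by
  have hint := integrable_comp_msg S T m (some d) g
  rw [Model.coordMeasure] at hint ⊢
  rw [integral_prod_symm _ hint]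
  simp only [Design.msg, Design.quant, Quantizer.integral_comp]
  have hmp := measurePreserving_eval (fun d => (T.second d).weight.toMeasure) d
  have := integral_map (μ := Measure.pi fun d => (T.second d).weight.toMeasure)
    (φ := Function.eval d) hmp.measurable.aemeasurable
    (f := fun j => ∑ v, S.msgProb ((T.second d).quantizer j) m v *
      g ((T.second d).quantizer j) v) (Measurable.of_discrete).aestronglyMeasurable
  rw [hmp.map_eq, PMF.integral_eq_sum] at this
  exact this.symm

theorem integral_llr (S : Model 𝒳 M) (T : Design 𝒳 M l) (m m' : Fin M) (s : Option (Fin M)) :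
    ∫ e, S.llr T m m' s e ∂S.coordMeasure T m = S.drift T m m' s := by
  cases s with
  | none => exact integral_comp_msg_none S T m fun φ => φ.llr S m m'
  | some d => exact integral_comp_msg_some S T m d fun φ => φ.llr S m m'

theorem Quantizer.sum_exp_neg_llr_le {S : Model 𝒳 M} (hS : S.FiniteDivergence)
    (φ : Quantizer 𝒳 l) (m m' : Fin M) :
    ∑ v, S.msgProb φ m v * Real.exp (-φ.llr S m m' v) ≤ 1 := by
  rw [← S.sum_msgProb φ m']
  refine Finset.sum_le_sum fun v _ => ?_
  by_cases h : S.msgProb φ m' v = 0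
  · simp [h, Model.msgProb_eq_zero hS h m]
  · have h' : S.msgProb φ m v ≠ 0 := fun h0 => h (Model.msgProb_eq_zero hS h0 m')
    have h1 : 0 < S.msgProb φ m v := lt_of_le_of_ne measureReal_nonneg h'.symm
    have h2 : 0 < S.msgProb φ m' v := lt_of_le_of_ne measureReal_nonneg (Ne.symm h)
    rw [Quantizer.llr, Real.exp_neg, Real.exp_log (by positivity)]
    exact le_of_eq (by field_simp)

theorem lintegral_exp_neg_llr_le {S : Model 𝒳 M} (hS : S.FiniteDivergence) (T : Design 𝒳 M l)
    (m m' : Fin M) (s : Option (Fin M)) :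
    ∫⁻ e, ENNReal.ofReal (Real.exp (-S.llr T m m' s e)) ∂S.coordMeasure T m ≤ 1 := by
  let g : Quantizer 𝒳 l → Fin l → ℝ := fun φ v => Real.exp (-φ.llr S m m' v)
  change ∫⁻ e, ENNReal.ofReal (g (T.quant s e.2) (T.msg s e)) ∂S.coordMeasure T m ≤ 1
  rw [← ofReal_integral_eq_lintegral_ofReal (integrable_comp_msg S T m s g)
    (ae_of_all _ fun _ => (Real.exp_pos _).le), ENNReal.ofReal_le_one]
  cases s with
  | none => rw [integral_comp_msg_none]; exact Quantizer.sum_exp_neg_llr_le hS _ m m'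
  | some d =>
    rw [integral_comp_msg_some]
    calc _ ≤ ∑ j, ((T.second d).weight j).toReal * 1 := by
          gcongr; exact Quantizer.sum_exp_neg_llr_le hS _ m m'
      _ = 1 := by
          simp only [mul_one]
          rw [← ENNReal.toReal_sum fun j _ => (T.second d).weight.apply_ne_top j,
            ← tsum_fintype (L := .unconditional _), (T.second d).weight.tsum_coe, ENNReal.toReal_one]

/-- The centred log-likelihood ratios are uniformly sub-Gaussian. -/
theorem exists_lintegral_exp_llr_le (S : Model 𝒳 M) (T : Design 𝒳 M l) (m : Fin M) :
    ∃ K : ℝ, 0 < K ∧ ∀ m' s (r : ℝ),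
      ∫⁻ e, ENNReal.ofReal (Real.exp (r * (S.llr T m m' s e - S.drift T m m' s)))
        ∂S.coordMeasure T m ≤ ENNReal.ofReal (Real.exp (K * r ^ 2)) := by
  obtain ⟨B, hB0, hB⟩ := exists_bound_quant T fun m' φ => φ.llr S m m'
  refine ⟨B ^ 2, by positivity, fun m' s r => ?_⟩
  have hsg := hasSubgaussianMGF_of_mem_Icc (μ := S.coordMeasure T m) (X := S.llr T m m' s)
    (a := -B) (b := B) (T.measurable_comp_msg s fun φ => φ.llr S m m').aemeasurable
    (ae_of_all _ fun e => abs_le.1 (hB m' s e.2 _))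
  rw [integral_llr] at hsg
  rw [← ofReal_integral_eq_lintegral_ofReal (hsg.integrable_exp_mul r)
    (ae_of_all _ fun _ => (Real.exp_pos _).le)]
  refine ENNReal.ofReal_le_ofReal ((hsg.mgf_le r).trans (Real.exp_le_exp.2 ?_))
  have : (((‖B - -B‖₊ / 2) ^ 2 : NNReal) : ℝ) = B ^ 2 := by
    push_cast
    rw [Real.norm_eq_abs, div_pow, sq_abs]; ring
  rw [this]
  nlinarith [mul_nonneg (sq_nonneg B) (sq_nonneg r)]

theorem ae_msgProb_pos {S : Model 𝒳 M} (hS : S.FiniteDivergence) (T : Design 𝒳 M l) (m : Fin M) :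
    ∀ᵐ e ∂S.coordMeasure T m, ∀ s m', 0 < S.msgProb (T.quant s e.2) m' (T.msg s e) := by
  have h1 : ∀ᵐ x ∂S.law m, ∀ s i m', 0 < S.msgProb (T.quant s i) m' ((T.quant s i).toFun x) := by
    refine ae_all_iff.2 fun s => ae_all_iff.2 fun i => ae_all_iff.2 fun m' => ?_
    rw [ae_iff]
    set φ := T.quant s i
    refine measure_mono_null (t := ⋃ v ∈ {v | S.msgProb φ m' v = 0}, φ.toFun ⁻¹' {v})
      (fun x hx => ?_) ?_
    · have h0 : S.msgProb φ m' (φ.toFun x) = 0 :=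
        le_antisymm (not_lt.1 hx) measureReal_nonneg
      exact Set.mem_biUnion (x := φ.toFun x) h0 rfl
    · refine (measure_biUnion_null_iff (Set.to_countable _)).2 fun v hv => ?_
      have := Model.msgProb_eq_zero hS (show S.msgProb φ m' v = 0 from hv) m
      rwa [Model.msgProb, measureReal_eq_zero_iff] at this
  filter_upwards [Measure.quasiMeasurePreserving_fst.ae h1] with e he s m'
  exact he s e.2 m'

/-- Paths on which every message has positive probability under all hypotheses. -/
def RegularPath (S : Model 𝒳 M) {T : Design 𝒳 M l} (ω : Path T) : Prop :=
  ∀ k s m', 0 < S.msgProb (T.quant s (ω k).2) m' (T.msg s (ω k))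

theorem ae_regularPath {S : Model 𝒳 M} (hS : S.FiniteDivergence) (T : Design 𝒳 M l) (m : Fin M) :
    ∀ᵐ ω ∂S.pathMeasure T m, RegularPath S ω :=
  ae_all_iff.2 fun k => (measurePreserving_eval_infinitePi
    (fun _ : ℕ => S.coordMeasure T m) k).quasiMeasurePreserving.ae (ae_msgProb_pos hS T m)

section Nonanticipating

/-- All that the fusion center could observe at one time, whichever quantizer is used. -/
def Design.obs (T : Design 𝒳 M l) (e : Coord T) :
    (Option (Fin M) → Fin l) × ((d : Fin M) → Fin (T.second d).size) :=
  (fun s => T.msg s e, e.2)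

theorem Design.measurable_obs (T : Design 𝒳 M l) : Measurable T.obs :=
  (measurable_pi_lambda _ fun s => T.measurable_msg s).prodMk measurable_snd

/-- `F` is a function of the observations at the first `n` times. -/
def Nonanticipating {T : Design 𝒳 M l} {α : Type*} (n : ℕ) (F : Path T → α) : Prop :=
  ∀ ω ω' : Path T, (∀ k < n, T.obs (ω k) = T.obs (ω' k)) → F ω = F ω'

variable {T : Design 𝒳 M l} {α : Type*} {n : ℕ} {F : Path T → α}

theorem Nonanticipating.dependsOn (hF : Nonanticipating n F) : DependsOn F (Set.Iio n) :=
  fun ω ω' h => hF ω ω' fun k hk => by rw [h k hk]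

theorem Nonanticipating.measurable [MeasurableSpace α] (hF : Nonanticipating n F) :
    Measurable F := by
  classical
  rcases isEmpty_or_nonempty (Path T) with he | ⟨⟨ω₀⟩⟩
  · exact measurable_of_empty F
  let Φ : Path T → Fin n → (Option (Fin M) → Fin l) × ((d : Fin M) → Fin (T.second d).size) :=
    fun ω k => T.obs (ω k)
  have hΦ : Measurable Φ :=
    measurable_pi_lambda _ fun k => T.measurable_obs.comp (measurable_pi_apply _)
  have hfac : Function.FactorsThrough F Φ := fun ω ω' h =>
    hF ω ω' fun k hk => congrFun h ⟨k, hk⟩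
  have hext : F = Function.extend Φ F (fun _ => F ω₀) ∘ Φ :=
    funext fun ω => (hfac.extend_apply _ ω).symm
  rw [hext]
  exact Measurable.of_discrete.comp hΦ

theorem Nonanticipating.measurableSet {p : Path T → Prop} (hp : Nonanticipating n p) :
    MeasurableSet {ω | p ω} :=
  measurableSet_setOfPred.2 hp.measurable

theorem Nonanticipating.mono {k : ℕ} (hF : Nonanticipating k F) (hkn : k ≤ n) :
    Nonanticipating n F :=
  fun ω ω' h => hF ω ω' fun i hi => h i (hi.trans_le hkn)

theorem Model.llr_congr (S : Model 𝒳 M) {e e' : Coord T} (h : T.obs e = T.obs e')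
    (m m' : Fin M) (s : Option (Fin M)) : S.llr T m m' s e = S.llr T m m' s e' := by
  have h1 : T.msg s e = T.msg s e' := congrFun (congrArg Prod.fst h) s
  have h2 : (T.obs e).2 = (T.obs e').2 := by rw [h]
  change e.2 = e'.2 at h2
  simp only [Model.llr, h1, h2]

end Nonanticipating

end TwoStage

end

noncomputable section

namespace TwoStage

section FirstTime

variable {A A' : ℕ → Prop} {n : ℕ}

theorem firstTime_le_iff : firstTime A ≤ n ↔ ∃ k ≤ n, A k := by
  constructor
  · intro h
    by_contra! hA
    have h1 : ((n + 1 : ℕ) : ℕ∞) ≤ firstTime A :=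
      le_iInf₂ fun k hk => by
        have : ¬ k ≤ n := fun h => hA k h hk
        exact_mod_cast (by omega : n + 1 ≤ k)
    have h2 := h1.trans h
    norm_cast at h2
    omega
  · rintro ⟨k, hk, hA⟩
    exact iInf₂_le_of_le k hA (by exact_mod_cast hk)

theorem lt_firstTime_iff : (n : ℕ∞) < firstTime A ↔ ∀ k ≤ n, ¬ A k := by
  rw [← not_le, firstTime_le_iff]; push Not; rfl

theorem firstTime_toNat_spec (h : firstTime A ≠ ⊤) : A (firstTime A).toNat := by
  obtain ⟨n, hn⟩ := ENat.ne_top_iff_exists.1 h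
  obtain ⟨k, hk, hA⟩ := firstTime_le_iff.1 hn.ge
  have h1 : firstTime A ≤ k := firstTime_le_iff.2 ⟨k, le_rfl, hA⟩
  rw [← hn] at h1 ⊢
  have : k = n := le_antisymm hk (by exact_mod_cast h1)
  simpa [← this] using hA

theorem firstTime_congr (h : ∀ k ≤ n, A k ↔ A' k) (hn : firstTime A ≤ n) :
    firstTime A = firstTime A' := by
  have key : ∀ {B B' : ℕ → Prop}, (∀ k ≤ n, B k ↔ B' k) → firstTime B ≤ n →
      firstTime B' ≤ firstTime B := by
    intro B B' hB hBn
    have htop : firstTime B ≠ ⊤ := ne_top_of_le_ne_top (ENat.natCast_ne_top n) hBn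
    have hs := firstTime_toNat_spec htop
    have hcoe := ENat.natCast_toNat htop
    have hle : (firstTime B).toNat ≤ n := by rw [← hcoe] at hBn; exact_mod_cast hBn
    rw [← hcoe]
    exact firstTime_le_iff.2 ⟨_, le_rfl, (hB _ hle).1 hs⟩
  have h1 := key h hn
  exact le_antisymm (key (fun k hk => (h k hk).symm) (h1.trans hn)) h1

end FirstTime

theorem le_apply_argmax {M : ℕ} [NeZero M] (p : Fin M → ℝ) (m : Fin M) : p m ≤ p (argmax p) := by
  classical
  have := Finset.min'_mem (Finset.univ.filter fun m => ∀ m', p m' ≤ p m)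
    (let ⟨m, hm⟩ := Finite.exists_max p; ⟨m, by simpa using hm⟩)
  exact (Finset.mem_filter.1 this).2 m

variable {𝒳 : Type*} [MeasurableSpace 𝒳] {M l : ℕ}

/-- The posterior distribution along a given sequence of quantizer choices. -/
def postOf (S : Model 𝒳 M) (T : Design 𝒳 M l) (prior : Fin M → ℝ) (s : ℕ → Option (Fin M))
    (ω : Path T) : ℕ → Fin M → ℝ
  | 0 => prior
  | n + 1 => S.update (postOf S T prior s ω n) (T.quant (s n) (ω n).2) (ω n).1

def llrSum (S : Model 𝒳 M) (T : Design 𝒳 M l) (m m' : Fin M) (s : ℕ → Option (Fin M))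
    (ω : Path T) (n : ℕ) : ℝ :=
  ∑ k ∈ Finset.range n, S.llr T m m' (s k) (ω k)

def driftSum (S : Model 𝒳 M) (T : Design 𝒳 M l) (m m' : Fin M) (s : ℕ → Option (Fin M))
    (n : ℕ) : ℝ :=
  ∑ k ∈ Finset.range n, S.drift T m m' (s k)

section Posterior

variable {S : Model 𝒳 M} {T : Design 𝒳 M l} {prior : Fin M → ℝ} {s s' : ℕ → Option (Fin M)}
  {ω ω' : Path T}

theorem postOf_congr : ∀ {n : ℕ}, (∀ k < n, s k = s' k) → (∀ k < n, T.obs (ω k) = T.obs (ω' k)) →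
    postOf S T prior s ω n = postOf S T prior s' ω' n
  | 0, _, _ => rfl
  | n + 1, hs, hω => by
    have ih := postOf_congr (n := n) (fun k hk => hs k (by omega))
      (fun k hk => hω k (by omega))
    have h := hω n (by omega)
    have h1 : T.msg (s n) (ω n) = T.msg (s n) (ω' n) := congrFun (congrArg Prod.fst h) (s n)
    have h2 : (T.obs (ω n)).2 = (T.obs (ω' n)).2 := by rw [h]
    change (ω n).2 = (ω' n).2 at h2
    simp only [Design.msg] at h1
    simp only [postOf, ih, ← hs n (by omega)]
    unfold Model.update
    rw [h1, h2]

theorem postOf_pos (hω : RegularPath S ω) (hprior : ∀ m, 0 < prior m) :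
    ∀ n m, 0 < postOf S T prior s ω n m
  | 0, m => hprior m
  | n + 1, m => by
    have h : ∀ m', 0 < postOf S T prior s ω n m' *
        S.msgProb (T.quant (s n) (ω n).2) m' ((T.quant (s n) (ω n).2).toFun (ω n).1) := fun m' =>
      mul_pos (postOf_pos hω hprior n m') (hω n (s n) m')
    exact div_pos (h m) (Finset.sum_pos (fun m' _ => h m') ⟨m, Finset.mem_univ m⟩)

theorem sum_postOf [NeZero M] (hω : RegularPath S ω) (hprior : ∀ m, 0 < prior m)
    (hsum : ∑ m, prior m = 1) : ∀ n, ∑ m, postOf S T prior s ω n m = 1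
  | 0 => hsum
  | n + 1 => by
    have h : ∀ m', 0 < postOf S T prior s ω n m' *
        S.msgProb (T.quant (s n) (ω n).2) m' ((T.quant (s n) (ω n).2).toFun (ω n).1) := fun m' =>
      mul_pos (postOf_pos hω hprior n m') (hω n (s n) m')
    simp only [postOf, Model.update]
    rw [← Finset.sum_div]
    exact div_self (Finset.sum_pos (fun m' _ => h m') ⟨0, Finset.mem_univ _⟩).ne'

theorem log_postOf_sub (hω : RegularPath S ω) (hprior : ∀ m, 0 < prior m) (m m' : Fin M) :
    ∀ n, Real.log (postOf S T prior s ω n m) - Real.log (postOf S T prior s ω n m')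
      = Real.log (prior m) - Real.log (prior m') + llrSum S T m m' s ω n
  | 0 => by simp [postOf, llrSum]
  | n + 1 => by
    have ih := log_postOf_sub hω hprior m m' n
    have hp := postOf_pos (s := s) hω hprior n
    have hq := hω n (s n)
    have hd : 0 < ∑ m', postOf S T prior s ω n m' *
        S.msgProb (T.quant (s n) (ω n).2) m' ((T.quant (s n) (ω n).2).toFun (ω n).1) :=
      Finset.sum_pos (fun m' _ => mul_pos (hp m') (hq m')) ⟨m, Finset.mem_univ m⟩
    simp only [llrSum] at ih ⊢
    rw [Finset.sum_range_succ, ← add_assoc, ← ih]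
    simp only [postOf, Model.update, Model.llr, Quantizer.llr]
    simp only [Design.msg] at hq ⊢
    rw [Real.log_div (mul_pos (hp m) (hq m)).ne' hd.ne',
      Real.log_div (mul_pos (hp m') (hq m')).ne' hd.ne', Real.log_mul (hp m).ne' (hq m).ne',
      Real.log_mul (hp m').ne' (hq m').ne', Real.log_div (hq m).ne' (hq m').ne']
    ring

theorem exists_prior_bound (prior : Fin M → ℝ) :
    ∃ Δ : ℝ, 0 ≤ Δ ∧ ∀ m m', |Real.log (prior m) - Real.log (prior m')| ≤ Δ := by
  obtain ⟨B, hB⟩ := (Set.finite_range fun p : Fin M × Fin M =>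
      |Real.log (prior p.1) - Real.log (prior p.2)|).bddAbove
  exact ⟨max B 0, le_max_right _ _, fun m m' => (hB ⟨(m, m'), rfl⟩).trans (le_max_left _ _)⟩

variable [NeZero M] {Δ x : ℝ} {n : ℕ} {m m' : Fin M}

theorem exists_llrSum_lt_of_postOf_lt (hω : RegularPath S ω) (hprior : ∀ m, 0 < prior m)
    (hsum : ∑ m, prior m = 1) (hΔ : ∀ m m', |Real.log (prior m) - Real.log (prior m')| ≤ Δ)
    (hx : 0 < x) (h : postOf S T prior s ω n m < 1 - x) :
    ∃ m' ≠ m, llrSum S T m m' s ω n < Δ + Real.log M - Real.log x := by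
  by_contra! hcon
  have hM : (0 : ℝ) < M := by exact_mod_cast NeZero.pos M
  have hp := postOf_pos (s := s) hω hprior n
  have hs1 := sum_postOf (s := s) hω hprior hsum n
  have hle : ∀ m' ∈ Finset.univ.erase m, postOf S T prior s ω n m' ≤ x / M := by
    intro m' hm'
    have h1 := hcon m' (Finset.ne_of_mem_erase hm')
    have h2 := log_postOf_sub (s := s) hω hprior m m' n
    have h3 := (abs_le.1 (hΔ m m')).1
    have h4 : Real.log (postOf S T prior s ω n m) ≤ 0 := by
      refine Real.log_nonpos (hp m).le ?_
      linarith
    have h5 : Real.log (postOf S T prior s ω n m') ≤ Real.log (x / M) := by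
      rw [Real.log_div hx.ne' hM.ne']; linarith
    exact (Real.log_le_log_iff (hp m') (by positivity)).1 h5
  have h1 := Finset.add_sum_erase Finset.univ (postOf S T prior s ω n) (Finset.mem_univ m)
  have h2 := Finset.sum_le_sum hle
  have h3 : ∑ _m' ∈ Finset.univ.erase m, x / (M : ℝ) ≤ x := by
    calc ∑ _m' ∈ Finset.univ.erase m, x / (M : ℝ) ≤ ∑ _m' : Fin M, x / (M : ℝ) :=
          Finset.sum_le_sum_of_subset_of_nonneg (Finset.erase_subset _ _)
            fun _ _ _ => by positivity
      _ = x := by simp; field_simp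
  linarith

theorem llrSum_le_of_le_postOf (hω : RegularPath S ω) (hprior : ∀ m, 0 < prior m)
    (hsum : ∑ m, prior m = 1) (hΔ : ∀ m m', |Real.log (prior m) - Real.log (prior m')| ≤ Δ)
    (hx2 : x ≤ 1 / 2) (hm : m' ≠ m) (h : 1 - x ≤ postOf S T prior s ω n m') :
    llrSum S T m m' s ω n ≤ Δ + Real.log 2 + Real.log x := by
  have hp := postOf_pos (s := s) hω hprior n
  have hs1 := sum_postOf (s := s) hω hprior hsum n
  have h1 : postOf S T prior s ω n m + postOf S T prior s ω n m' ≤ 1 := by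
    rw [← hs1, ← Finset.sum_pair hm.symm]
    exact Finset.sum_le_sum_of_subset_of_nonneg (Finset.subset_univ _) fun i _ _ => (hp i).le
  have h2 := log_postOf_sub (s := s) hω hprior m m' n
  have h3 := (abs_le.1 (hΔ m m')).1
  have h4 : Real.log (postOf S T prior s ω n m) ≤ Real.log x :=
    Real.log_le_log (hp m) (by linarith)
  have h5 : Real.log (1 / 2) ≤ Real.log (postOf S T prior s ω n m') :=
    Real.log_le_log (by norm_num) (by linarith)
  rw [one_div, Real.log_inv] at h5
  linarith

theorem le_llrSum_of_le_postOf (hω : RegularPath S ω) (hprior : ∀ m, 0 < prior m)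
    (hsum : ∑ m, prior m = 1) (hΔ : ∀ m m', |Real.log (prior m) - Real.log (prior m')| ≤ Δ)
    (hx2 : x ≤ 1 / 2) (hm : m' ≠ m) (h : 1 - x ≤ postOf S T prior s ω n m) :
    -Δ - Real.log 2 - Real.log x ≤ llrSum S T m m' s ω n := by
  have h1 := llrSum_le_of_le_postOf (m := m') (m' := m) hω hprior hsum hΔ hx2 hm.symm h
  have h2 := log_postOf_sub (s := s) hω hprior m m' n
  have h3 := log_postOf_sub (s := s) hω hprior m' m n
  linarith

end Posterior

section RuleBounds

variable {S : Model 𝒳 M} {T : Design 𝒳 M l} {s : Path T → ℕ → Option (Fin M)}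

theorem nonanticipating_llr (hs : ∀ n, Nonanticipating n fun ω => s ω n) (m m' : Fin M) (n : ℕ) :
    Nonanticipating (n + 1) fun ω : Path T => S.llr T m m' (s ω n) (ω n) := fun ω ω' h => by
  have h1 : s ω n = s ω' n := hs n ω ω' fun k hk => h k (by omega)
  simp only [h1, S.llr_congr (h n (by omega))]

theorem nonanticipating_drift (hs : ∀ n, Nonanticipating n fun ω => s ω n) (m m' : Fin M)
    (n : ℕ) : Nonanticipating n fun ω : Path T => S.drift T m m' (s ω n) := fun ω ω' h => by
  simp only [hs n ω ω' h]

theorem measure_exists_llrSum_le (hS : S.FiniteDivergence)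
    (hs : ∀ n, Nonanticipating n fun ω => s ω n) (m m' : Fin M) (t : ℝ) :
    S.pathMeasure T m {ω | ∃ n, llrSum S T m m' (s ω) ω n ≤ -t} ≤ ENNReal.ofReal (Real.exp (-t)) := by
  refine measure_exists_sum_le_neg_le_exp (ν := S.coordMeasure T m)
    (Y := fun n ω => S.llr T m m' (s ω n) (ω n))
    (fun n => (nonanticipating_llr hs m m' n).measurable)
    (fun n => (nonanticipating_llr hs m m' n).dependsOn) (fun n ω => ?_) t
  simp only [update_eq_of_dependsOn (hs n).dependsOn, Function.update_self]
  exact lintegral_exp_neg_llr_le hS T m m' (s ω n)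

/-- Two-sided concentration of the log-likelihood ratios about their compensators. -/
theorem exists_measure_llrSum_sub_driftSum_le (S : Model 𝒳 M) (T : Design 𝒳 M l) (m : Fin M) :
    ∃ K : ℝ, 0 < K ∧ ∀ s : Path T → ℕ → Option (Fin M), (∀ n, Nonanticipating n fun ω => s ω n) →
      ∀ (m' : Fin M) (n : ℕ) (a t : ℝ), 0 < a → n ≤ a → 0 ≤ t →
      S.pathMeasure T m {ω | t ≤ llrSum S T m m' (s ω) ω n - driftSum S T m m' (s ω) n}
        ≤ ENNReal.ofReal (Real.exp (-(t ^ 2 / (4 * K * a)))) ∧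
      S.pathMeasure T m {ω | llrSum S T m m' (s ω) ω n - driftSum S T m m' (s ω) n ≤ -t}
        ≤ ENNReal.ofReal (Real.exp (-(t ^ 2 / (4 * K * a)))) := by
  obtain ⟨K, hK0, hK⟩ := exists_lintegral_exp_llr_le S T m
  refine ⟨K, hK0, fun s hs m' n a t ha hna ht => ?_⟩
  have hY : ∀ (q : ℝ) (n : ℕ), Nonanticipating (n + 1) fun ω : Path T =>
      q * (S.llr T m m' (s ω n) (ω n) - S.drift T m m' (s ω n)) := fun q n ω ω' h => by
    have h1 := nonanticipating_llr (S := S) hs m m' n ω ω' h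
    have h2 := (nonanticipating_drift (S := S) hs m m' n).mono (Nat.le_succ n) ω ω' h
    simp only at h1 h2
    simp only [h1, h2]
  have key : ∀ q : ℝ, q ^ 2 = 1 → S.pathMeasure T m
      {ω | t ≤ ∑ k ∈ Finset.range n, q * (S.llr T m m' (s ω k) (ω k) - S.drift T m m' (s ω k))}
        ≤ ENNReal.ofReal (Real.exp (-(t ^ 2 / (4 * K * a)))) := by
    intro q hq
    refine measure_sum_ge_le_exp (ν := S.coordMeasure T m)
      (Y := fun n ω => q * (S.llr T m m' (s ω n) (ω n) - S.drift T m m' (s ω n))) hK0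
      (fun n => (hY q n).measurable) (fun n => (hY q n).dependsOn) (fun n ω r => ?_) ha hna ht
    simp only [update_eq_of_dependsOn (hs n).dependsOn, Function.update_self]
    have h := hK m' (s ω n) (r * q)
    simp only [mul_assoc] at h
    rwa [mul_pow, hq, mul_one] at h
  constructor
  · simpa [llrSum, driftSum] using key 1 (by norm_num)
  · have h := key (-1) (by norm_num)
    simp only [← Finset.mul_sum, Finset.sum_sub_distrib] at h
    refine le_trans (measure_mono fun ω hω => ?_) h
    simp only [Set.mem_ofPred_eq, llrSum, driftSum] at hω ⊢
    linarith

/-- Exponential decay of the probability that the posterior of the true hypothesis is still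
small. -/
theorem exists_measure_postOf_lt_le [NeZero M] (hS : S.FiniteDivergence) {prior : Fin M → ℝ}
    (hprior : ∀ m, 0 < prior m) (hsum : ∑ m, prior m = 1) {Δ : ℝ}
    (hΔ : ∀ m m', |Real.log (prior m) - Real.log (prior m')| ≤ Δ) {m : Fin M} {μ₀ : ℝ}
    (hμ₀ : 0 < μ₀) (hdrift : ∀ m' ≠ m, ∀ s, μ₀ ≤ S.drift T m m' s) :
    ∃ γ : ℝ, 0 < γ ∧ ∀ s : Path T → ℕ → Option (Fin M), (∀ n, Nonanticipating n fun ω => s ω n) →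
      ∀ (x : ℝ) (n : ℕ), 0 < x → 2 * (Δ + Real.log M - Real.log x) ≤ μ₀ * n →
      S.pathMeasure T m {ω | postOf S T prior (s ω) ω n m < 1 - x}
        ≤ ENNReal.ofReal (M * Real.exp (-(γ * n))) := by
  obtain ⟨K, hK0, hK⟩ := exists_measure_llrSum_sub_driftSum_le S T m
  refine ⟨μ₀ ^ 2 / (16 * K), by positivity, fun s hs x n hx hn => ?_⟩
  have hM : (1 : ℝ) ≤ M := by exact_mod_cast NeZero.pos M
  rcases Nat.eq_zero_or_pos n with rfl | hn0
  · refine prob_le_one.trans ?_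
    rw [← ENNReal.ofReal_one]
    exact ENNReal.ofReal_le_ofReal (by simpa using hM)
  have hn1 : (0 : ℝ) < n := by exact_mod_cast hn0
  set t : ℝ := μ₀ * n / 2 with ht
  have hsub : {ω | postOf S T prior (s ω) ω n m < 1 - x} ⊆ {ω | ¬ RegularPath S ω} ∪
      ⋃ m', {ω | m' ≠ m ∧ llrSum S T m m' (s ω) ω n - driftSum S T m m' (s ω) n ≤ -t} := by
    intro ω hω
    by_cases hreg : RegularPath S ω
    · right
      obtain ⟨m', hm', hlt⟩ := exists_llrSum_lt_of_postOf_lt hreg hprior hsum hΔ hx hω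
      have hd : μ₀ * n ≤ driftSum S T m m' (s ω) n := by
        calc μ₀ * n = ∑ _k ∈ Finset.range n, μ₀ := by simp [mul_comm]
          _ ≤ _ := Finset.sum_le_sum fun k _ => hdrift m' hm' _
      exact Set.mem_iUnion.2 ⟨m', hm', by rw [ht]; linarith⟩
    · exact Or.inl hreg
  calc _ ≤ _ := measure_mono hsub
    _ ≤ S.pathMeasure T m {ω | ¬ RegularPath S ω} + ∑ m', S.pathMeasure T m
        {ω | m' ≠ m ∧ llrSum S T m m' (s ω) ω n - driftSum S T m m' (s ω) n ≤ -t} :=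
      (measure_union_le _ _).trans (by gcongr; exact measure_iUnion_fintype_le _ _)
    _ ≤ 0 + ∑ _m' : Fin M, ENNReal.ofReal (Real.exp (-(t ^ 2 / (4 * K * n)))) := by
      gcongr with m'
      · exact (ae_iff.1 (ae_regularPath hS T m)).le
      · exact (measure_mono fun ω hω => hω.2).trans
          (hK s hs m' n n t hn1 le_rfl (by positivity)).2
    _ = _ := by
      rw [zero_add, Finset.sum_const, Finset.card_univ, Fintype.card_fin, nsmul_eq_mul,
        ENNReal.ofReal_mul (by positivity), ENNReal.ofReal_natCast]
      congr 4
      rw [ht]; field_simp; ring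

end RuleBounds

end TwoStage

end

noncomputable section

namespace TwoStage

variable {𝒳 : Type*} [MeasurableSpace 𝒳] {M l : ℕ} [NeZero M]

open Classical in
/-- The two-stage rule: `none` during the first stage, `some D₀` afterwards. -/
def choice (S : Model 𝒳 M) (T : Design 𝒳 M l) (prior : Fin M → ℝ) (c : ℝ) (ω : Path T) (n : ℕ) :
    Option (Fin M) :=
  if ((n + 1 : ℕ) : ℕ∞) ≤ N₀ S T prior c ω then none else some (D₀ S T prior c ω)

section Paths

variable {S : Model 𝒳 M} {T : Design 𝒳 M l} {prior : Fin M → ℝ} {c : ℝ} {ω : Path T}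

theorem posterior₁_eq {𝒳 : Type*} [MeasurableSpace 𝒳] {M l : ℕ} (S : Model 𝒳 M)
    (T : Design 𝒳 M l) (prior : Fin M → ℝ) (ω : Path T) :
    ∀ n, posterior₁ S T prior ω n = postOf S T prior (fun _ => none) ω n
  | 0 => rfl
  | n + 1 => by rw [posterior₁, postOf, posterior₁_eq S T prior ω n]; rfl

theorem posterior_eq (S : Model 𝒳 M) (T : Design 𝒳 M l) (prior : Fin M → ℝ) (c : ℝ) (ω : Path T) :
    ∀ n, posterior S T prior c ω n = postOf S T prior (choice S T prior c ω) ω n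
  | 0 => rfl
  | n + 1 => by
    have h : usedQuantizer S T prior c ω n = T.quant (choice S T prior c ω n) (ω n).2 := by
      unfold usedQuantizer choice
      split_ifs <;> rfl
    rw [posterior, postOf, posterior_eq S T prior c ω n, h]

theorem choice_of_le {k n : ℕ} (h : N₀ S T prior c ω ≤ k) (hkn : k ≤ n) :
    choice S T prior c ω n = some (D₀ S T prior c ω) := by
  have : ¬ ((n + 1 : ℕ) : ℕ∞) ≤ N₀ S T prior c ω := fun h' => by
    have := h'.trans h
    norm_cast at this
    omega
  exact if_neg this

theorem nonanticipating_posterior₁ {𝒳 : Type*} [MeasurableSpace 𝒳] {M l : ℕ} (S : Model 𝒳 M)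
    (T : Design 𝒳 M l) (prior : Fin M → ℝ) (n : ℕ) :
    Nonanticipating n fun ω : Path T => posterior₁ S T prior ω n := fun ω ω' h => by
  simp only [posterior₁_eq]
  exact postOf_congr (fun _ _ => rfl) h

theorem nonanticipating_choice (S : Model 𝒳 M) (T : Design 𝒳 M l) (prior : Fin M → ℝ) (c : ℝ)
    (n : ℕ) : Nonanticipating n fun ω : Path T => choice S T prior c ω n := by
  intro ω ω' h
  have hp : ∀ k ≤ n, posterior₁ S T prior ω k = posterior₁ S T prior ω' k := fun k hk =>
    (nonanticipating_posterior₁ S T prior k).mono hk ω ω' h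
  have hN : ∀ k ≤ n, (∃ m, 1 - T.u c ≤ posterior₁ S T prior ω k m) ↔
      ∃ m, 1 - T.u c ≤ posterior₁ S T prior ω' k m := fun k hk => by rw [hp k hk]
  by_cases h0 : N₀ S T prior c ω ≤ n
  · have heq : N₀ S T prior c ω = N₀ S T prior c ω' := firstTime_congr hN h0
    have hle : (N₀ S T prior c ω').toNat ≤ n := by
      rw [← heq]; exact ENat.toNat_le_of_le_natCast h0
    have hD : D₀ S T prior c ω = D₀ S T prior c ω' := by
      unfold D₀; rw [heq, hp _ hle]
    simp only [choice, heq, hD]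
  · have h0' : ¬ N₀ S T prior c ω' ≤ n := fun h' => h0 (by
      have heq : N₀ S T prior c ω' = N₀ S T prior c ω :=
        firstTime_congr (fun k hk => (hN k hk).symm) h'
      rwa [← heq])
    have h1 : ((n + 1 : ℕ) : ℕ∞) ≤ N₀ S T prior c ω := by
      push_cast; exact Order.add_one_le_of_lt (not_le.1 h0)
    have h2 : ((n + 1 : ℕ) : ℕ∞) ≤ N₀ S T prior c ω' := by
      push_cast; exact Order.add_one_le_of_lt (not_le.1 h0')
    simp only [choice, h1, h2, if_true]

theorem nonanticipating_posterior (S : Model 𝒳 M) (T : Design 𝒳 M l) (prior : Fin M → ℝ) (c : ℝ)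
    (n : ℕ) : Nonanticipating n fun ω : Path T => posterior S T prior c ω n := fun ω ω' h => by
  simp only [posterior_eq]
  exact postOf_congr
    (fun k hk => (nonanticipating_choice S T prior c k).mono hk.le ω ω' h) h

theorem N₀_le_iff {𝒳 : Type*} [MeasurableSpace 𝒳] {M l : ℕ} {S : Model 𝒳 M}
    {T : Design 𝒳 M l} {prior : Fin M → ℝ} {c : ℝ} {ω : Path T} {n : ℕ} :
    N₀ S T prior c ω ≤ n ↔ ∃ k ≤ n, ∃ m, 1 - T.u c ≤ posterior₁ S T prior ω k m :=
  firstTime_le_iff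

theorem nonanticipating_N₀_le {𝒳 : Type*} [MeasurableSpace 𝒳] {M l : ℕ} (S : Model 𝒳 M)
    (T : Design 𝒳 M l) (prior : Fin M → ℝ) (c : ℝ) (n : ℕ) :
    Nonanticipating n fun ω : Path T => N₀ S T prior c ω ≤ n := fun ω ω' h => by
  simp only [N₀_le_iff, eq_iff_iff]
  refine exists_congr fun k => and_congr_right fun hk => ?_
  have : posterior₁ S T prior ω k = posterior₁ S T prior ω' k :=
    (nonanticipating_posterior₁ S T prior k).mono hk ω ω' h
  rw [this]

theorem nonanticipating_N_le (S : Model 𝒳 M) (T : Design 𝒳 M l) (prior : Fin M → ℝ) (c : ℝ)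
    (n : ℕ) : Nonanticipating n fun ω : Path T => N S T prior c ω ≤ n := fun ω ω' h => by
  simp only [N, firstTime_le_iff, eq_iff_iff]
  refine exists_congr fun k => and_congr_right fun hk => ?_
  have h1 : posterior S T prior c ω k = posterior S T prior c ω' k :=
    (nonanticipating_posterior S T prior c k).mono hk ω ω' h
  have h2 : (N₀ S T prior c ω ≤ k) = (N₀ S T prior c ω' ≤ k) :=
    (nonanticipating_N₀_le S T prior c k).mono hk ω ω' h
  rw [h1, h2]

theorem measurableSet_N_le (S : Model 𝒳 M) (T : Design 𝒳 M l) (prior : Fin M → ℝ) (c : ℝ)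
    (n : ℕ) : MeasurableSet {ω : Path T | N S T prior c ω ≤ n} :=
  (nonanticipating_N_le S T prior c n).measurableSet

theorem le_posterior₁_D₀ (h : N₀ S T prior c ω ≠ ⊤) :
    1 - T.u c ≤ posterior₁ S T prior ω (N₀ S T prior c ω).toNat (D₀ S T prior c ω) := by
  obtain ⟨m, hm⟩ := firstTime_toNat_spec h
  exact hm.trans (le_apply_argmax _ m)

theorem le_posterior_D (h : N S T prior c ω ≠ ⊤) :
    1 - c ≤ posterior S T prior c ω (N S T prior c ω).toNat (D S T prior c ω) := by
  obtain ⟨-, m, hm⟩ := firstTime_toNat_spec h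
  exact hm.trans (le_apply_argmax _ m)

theorem posterior_lt_of_lt_N {k n : ℕ} (h0 : N₀ S T prior c ω ≤ k) (hkn : k ≤ n)
    (h : (n : ℕ∞) < N S T prior c ω) (m : Fin M) : posterior S T prior c ω n m < 1 - c := by
  have := lt_firstTime_iff.1 h n le_rfl
  push Not at this
  exact this (h0.trans (by exact_mod_cast hkn)) m

theorem posterior₁_lt_of_lt_N₀ {𝒳 : Type*} [MeasurableSpace 𝒳] {M l : ℕ} {S : Model 𝒳 M}
    {T : Design 𝒳 M l} {prior : Fin M → ℝ} {c : ℝ} {ω : Path T} {n : ℕ}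
    (h : (n : ℕ∞) < N₀ S T prior c ω) (m : Fin M) :
    posterior₁ S T prior ω n m < 1 - T.u c := by
  have := lt_firstTime_iff.1 h n le_rfl
  push Not at this
  exact this m

end Paths

theorem sum_range_ite_lt_le {k : ℕ} {b : ℝ} (hb : 0 ≤ b) (n : ℕ) :
    ∑ i ∈ Finset.range n, (if i < k then b else 0) ≤ k * b := by
  rw [← Finset.sum_filter, Finset.sum_const, nsmul_eq_mul]
  gcongr
  calc _ ≤ (Finset.range k).card := Finset.card_le_card fun i hi => by
        simp only [Finset.mem_filter, Finset.mem_range] at hi ⊢; exact hi.2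
    _ = k := Finset.card_range k

section Bounds

variable {S : Model 𝒳 M} {T : Design 𝒳 M l} {prior : Fin M → ℝ} {Δ : ℝ} {m : Fin M}

theorem measure_exists_le_postOf_le (hS : S.FiniteDivergence) (hprior : ∀ m, 0 < prior m)
    (hsum : ∑ m, prior m = 1) (hΔ : ∀ m m', |Real.log (prior m) - Real.log (prior m')| ≤ Δ)
    {s : Path T → ℕ → Option (Fin M)} (hs : ∀ n, Nonanticipating n fun ω => s ω n) {x : ℝ}
    (hx : 0 < x) (hx2 : x ≤ 1 / 2) :
    S.pathMeasure T m {ω | ∃ n, ∃ m' ≠ m, 1 - x ≤ postOf S T prior (s ω) ω n m'}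
      ≤ ENNReal.ofReal (M * (2 * Real.exp Δ) * x) := by
  set t : ℝ := -(Δ + Real.log 2 + Real.log x) with ht
  calc _ ≤ S.pathMeasure T m ({ω | ¬ RegularPath S ω} ∪
        ⋃ m', {ω | ∃ n, llrSum S T m m' (s ω) ω n ≤ -t}) := by
        refine measure_mono fun ω hω => ?_
        by_cases hreg : RegularPath S ω
        · obtain ⟨n, m', hm', h⟩ := hω
          have := llrSum_le_of_le_postOf hreg hprior hsum hΔ hx2 hm' h
          exact Or.inr (Set.mem_iUnion.2 ⟨m', n, by rw [ht]; linarith⟩)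
        · exact Or.inl hreg
    _ ≤ S.pathMeasure T m {ω | ¬ RegularPath S ω} + ∑ m', S.pathMeasure T m
        {ω | ∃ n, llrSum S T m m' (s ω) ω n ≤ -t} :=
      (measure_union_le _ _).trans (by gcongr; exact measure_iUnion_fintype_le _ _)
    _ ≤ 0 + ∑ _m' : Fin M, ENNReal.ofReal (Real.exp (-t)) := by
      gcongr with m'
      · exact (ae_iff.1 (ae_regularPath hS T m)).le
      · exact measure_exists_llrSum_le hS hs m m' t
    _ = _ := by
      rw [zero_add, Finset.sum_const, Finset.card_univ, Fintype.card_fin, nsmul_eq_mul, mul_assoc,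
        ENNReal.ofReal_mul (by positivity), ENNReal.ofReal_natCast, ht, neg_neg, Real.exp_add,
        Real.exp_add, Real.exp_log hx, Real.exp_log (by norm_num), mul_comm (Real.exp Δ)]

theorem measure_D₀_ne_le (hS : S.FiniteDivergence) (hprior : ∀ m, 0 < prior m)
    (hsum : ∑ m, prior m = 1) (hΔ : ∀ m m', |Real.log (prior m) - Real.log (prior m')| ≤ Δ)
    {c : ℝ} (hu : 0 < T.u c) (hu2 : T.u c ≤ 1 / 2)
    (hN : S.pathMeasure T m {ω | N₀ S T prior c ω = ⊤} = 0) :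
    S.pathMeasure T m {ω | D₀ S T prior c ω ≠ m}
      ≤ ENNReal.ofReal (M * (2 * Real.exp Δ) * T.u c) := by
  have h := measure_exists_le_postOf_le (T := T) (m := m) hS hprior hsum hΔ
    (s := fun _ _ => none) (fun _ _ _ _ => rfl) hu hu2
  refine (measure_mono (t := {ω | N₀ S T prior c ω = ⊤} ∪ {ω | ∃ n, ∃ m' ≠ m,
    1 - T.u c ≤ postOf S T prior (fun _ => none) ω n m'}) fun ω hω => ?_).trans
      (((measure_union_le _ _).trans_eq (by rw [hN, zero_add])).trans h)
  by_cases htop : N₀ S T prior c ω = ⊤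
  · exact Or.inl htop
  · exact Or.inr ⟨_, _, hω, by rw [← posterior₁_eq]; exact le_posterior₁_D₀ htop⟩

theorem measure_D_ne_le (hS : S.FiniteDivergence) (hprior : ∀ m, 0 < prior m)
    (hsum : ∑ m, prior m = 1) (hΔ : ∀ m m', |Real.log (prior m) - Real.log (prior m')| ≤ Δ)
    {c : ℝ} (hc : 0 < c) (hc2 : c ≤ 1 / 2)
    (hN : S.pathMeasure T m {ω | N S T prior c ω = ⊤} = 0) :
    S.pathMeasure T m {ω | D S T prior c ω ≠ m} ≤ ENNReal.ofReal (M * (2 * Real.exp Δ) * c) := by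
  have h := measure_exists_le_postOf_le (T := T) (m := m) hS hprior hsum hΔ
    (nonanticipating_choice S T prior c) hc hc2
  refine (measure_mono (t := {ω | N S T prior c ω = ⊤} ∪ {ω | ∃ n, ∃ m' ≠ m,
    1 - c ≤ postOf S T prior (choice S T prior c ω) ω n m'}) fun ω hω => ?_).trans
      (((measure_union_le _ _).trans_eq (by rw [hN, zero_add])).trans h)
  by_cases htop : N S T prior c ω = ⊤
  · exact Or.inl htop
  · exact Or.inr ⟨_, _, hω, by rw [← posterior_eq]; exact le_posterior_D htop⟩

/-- Exponential tails of the durations of the first stage and of the whole test. -/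
theorem exists_measure_lt_N_le (T : Design 𝒳 M l) (hS : S.FiniteDivergence)
    (hprior : ∀ m, 0 < prior m) (hsum : ∑ m, prior m = 1)
    (hΔ : ∀ m m', |Real.log (prior m) - Real.log (prior m')| ≤ Δ) {μ₀ : ℝ}
    (hμ₀ : 0 < μ₀) (hdrift : ∀ m' ≠ m, ∀ s, μ₀ ≤ S.drift T m m' s) :
    ∃ γ : ℝ, 0 < γ ∧ ∀ (c : ℝ) (n : ℕ), 0 < T.u c →
      2 * (Δ + Real.log M - Real.log (T.u c)) ≤ μ₀ * n →
      S.pathMeasure T m {ω | (n : ℕ∞) < N₀ S T prior c ω}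
        ≤ ENNReal.ofReal (M * Real.exp (-(γ * n))) ∧
      (0 < c → 2 * (Δ + Real.log M - Real.log c) ≤ μ₀ * n →
        S.pathMeasure T m {ω | (n : ℕ∞) < N S T prior c ω}
          ≤ ENNReal.ofReal (2 * M * Real.exp (-(γ * n)))) := by
  obtain ⟨γ, hγ0, hγ⟩ := exists_measure_postOf_lt_le (T := T) hS hprior hsum hΔ hμ₀ hdrift
  refine ⟨γ, hγ0, fun c n hu hun => ?_⟩
  have h0 : S.pathMeasure T m {ω | (n : ℕ∞) < N₀ S T prior c ω}
      ≤ ENNReal.ofReal (M * Real.exp (-(γ * n))) := by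
    refine (measure_mono fun ω hω => ?_).trans
      (hγ (fun _ _ => none) (fun _ _ _ _ => rfl) (T.u c) n hu hun)
    have := posterior₁_lt_of_lt_N₀ hω m
    rwa [posterior₁_eq] at this
  refine ⟨h0, fun hc hcn => ?_⟩
  have h1 := hγ _ (nonanticipating_choice S T prior c) c n hc hcn
  refine (measure_mono (t := {ω | (n : ℕ∞) < N₀ S T prior c ω} ∪
    {ω | postOf S T prior (choice S T prior c ω) ω n m < 1 - c}) fun ω hω => ?_).trans
    ((measure_union_le _ _).trans ((add_le_add h0 h1).trans_eq ?_))
  · by_cases hN : N₀ S T prior c ω ≤ n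
    · right
      have := posterior_lt_of_lt_N hN le_rfl hω m
      rwa [posterior_eq] at this
    · exact Or.inl (not_le.1 hN)
  · rw [← ENNReal.ofReal_add (by positivity) (by positivity)]
    congr 1; ring

/-- The test rarely lasts longer than predicted by the second-stage information number. -/
theorem exists_measure_lt_N_le_add (T : Design 𝒳 M l) (hS : S.FiniteDivergence)
    (hprior : ∀ m, 0 < prior m) (hsum : ∑ m, prior m = 1)
    (hΔ : ∀ m m', |Real.log (prior m) - Real.log (prior m')| ≤ Δ) {I : ℝ} (hI : 0 ≤ I)
    (hdrift : ∀ m' ≠ m, ∀ s, 0 ≤ S.drift T m m' s)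
    (hdriftI : ∀ m' ≠ m, I ≤ S.drift T m m' (some m)) :
    ∃ K : ℝ, 0 < K ∧ ∀ (c : ℝ) (k n : ℕ) (a t : ℝ), 0 < c → k ≤ n → 0 < a → n ≤ a → 0 ≤ t →
      t + (Δ + Real.log M - Real.log c) ≤ (n - k) * I →
      S.pathMeasure T m {ω | (n : ℕ∞) < N S T prior c ω}
        ≤ S.pathMeasure T m {ω | (k : ℕ∞) < N₀ S T prior c ω} +
          S.pathMeasure T m {ω | D₀ S T prior c ω ≠ m} +
          ENNReal.ofReal (M * Real.exp (-(t ^ 2 / (4 * K * a)))) := by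
  obtain ⟨K, hK0, hK⟩ := exists_measure_llrSum_sub_driftSum_le S T m
  refine ⟨K, hK0, fun c k n a t hc hkn ha hna ht hle => ?_⟩
  have hB : ∀ m', S.pathMeasure T m {ω | llrSum S T m m' (choice S T prior c ω) ω n -
      driftSum S T m m' (choice S T prior c ω) n ≤ -t} ≤ _ := fun m' =>
    (hK _ (nonanticipating_choice S T prior c) m' n a t ha hna ht).2
  have hsub : {ω | (n : ℕ∞) < N S T prior c ω} ⊆
      ({ω | (k : ℕ∞) < N₀ S T prior c ω} ∪ {ω | D₀ S T prior c ω ≠ m}) ∪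
      ({ω | ¬ RegularPath S ω} ∪ ⋃ m', {ω | llrSum S T m m' (choice S T prior c ω) ω n -
        driftSum S T m m' (choice S T prior c ω) n ≤ -t}) := by
    intro ω hω
    by_cases hN : (k : ℕ∞) < N₀ S T prior c ω
    · exact Or.inl (Or.inl hN)
    by_cases hD : D₀ S T prior c ω ≠ m
    · exact Or.inl (Or.inr hD)
    by_cases hreg : RegularPath S ω
    swap
    · exact Or.inr (Or.inl hreg)
    right; right
    rw [not_lt] at hN
    rw [not_not] at hD
    have hp := posterior_lt_of_lt_N hN hkn hω m
    rw [posterior_eq] at hp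
    obtain ⟨m', hm', hlt⟩ := exists_llrSum_lt_of_postOf_lt hreg hprior hsum hΔ hc hp
    have hd : ((n : ℝ) - k) * I ≤ driftSum S T m m' (choice S T prior c ω) n := by
      calc ((n : ℝ) - k) * I ≤ n * I - ∑ i ∈ Finset.range n, (if i < k then I else 0) := by
            have := sum_range_ite_lt_le (k := k) hI n
            linarith
        _ = ∑ i ∈ Finset.range n, (I - if i < k then I else 0) := by
            simp [Finset.sum_sub_distrib]
        _ ≤ _ := by
            refine Finset.sum_le_sum fun i _ => ?_
            split_ifs with h
            · simpa using hdrift m' hm' _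
            · rw [choice_of_le hN (not_lt.1 h), hD, sub_zero]
              exact hdriftI m' hm'
    refine Set.mem_iUnion.2 ⟨m', ?_⟩
    simp only [Set.mem_ofPred_eq]
    linarith
  refine (measure_mono hsub).trans ((measure_union_le _ _).trans ?_)
  gcongr
  · exact measure_union_le _ _
  calc _ ≤ S.pathMeasure T m {ω | ¬ RegularPath S ω} + ∑ m', S.pathMeasure T m
        {ω | llrSum S T m m' (choice S T prior c ω) ω n -
          driftSum S T m m' (choice S T prior c ω) n ≤ -t} :=
      (measure_union_le _ _).trans (by gcongr; exact measure_iUnion_fintype_le _ _)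
    _ ≤ 0 + ∑ _m' : Fin M, ENNReal.ofReal (Real.exp (-(t ^ 2 / (4 * K * a)))) := by
      gcongr with m'
      · exact (ae_iff.1 (ae_regularPath hS T m)).le
      · exact hB m'
    _ = _ := by
      rw [zero_add, Finset.sum_const, Finset.card_univ, Fintype.card_fin, nsmul_eq_mul,
        ENNReal.ofReal_mul (by positivity), ENNReal.ofReal_natCast]

/-- The test rarely stops earlier than predicted by the second-stage information number. -/
theorem exists_measure_N_le_le_add (T : Design 𝒳 M l) (hS : S.FiniteDivergence)
    (hprior : ∀ m, 0 < prior m) (hsum : ∑ m, prior m = 1)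
    (hΔ : ∀ m m', |Real.log (prior m) - Real.log (prior m')| ≤ Δ) {I B : ℝ} (hI : 0 ≤ I)
    (hB0 : 0 ≤ B) {m' : Fin M} (hm' : m' ≠ m) (hdrift : ∀ s, S.drift T m m' s ≤ B)
    (hdriftI : S.drift T m m' (some m) = I) :
    ∃ K : ℝ, 0 < K ∧ ∀ (c : ℝ) (k n : ℕ) (a t : ℝ), c ≤ 1 / 2 → 0 < a → n ≤ a → 0 ≤ t →
      t + (k * B + a * I) ≤ -Δ - Real.log 2 - Real.log c →
      S.pathMeasure T m {ω | N S T prior c ω ≤ n}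
        ≤ S.pathMeasure T m {ω | (k : ℕ∞) < N₀ S T prior c ω} +
          S.pathMeasure T m {ω | D₀ S T prior c ω ≠ m} +
          S.pathMeasure T m {ω | D S T prior c ω ≠ m} +
          ENNReal.ofReal ((n + 1) * Real.exp (-(t ^ 2 / (4 * K * a)))) := by
  obtain ⟨K, hK0, hK⟩ := exists_measure_llrSum_sub_driftSum_le S T m
  refine ⟨K, hK0, fun c k n a t hc2 ha hna ht hle => ?_⟩
  have hdev : ∀ j ∈ Finset.range (n + 1), S.pathMeasure T m
      {ω | t ≤ llrSum S T m m' (choice S T prior c ω) ω j -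
        driftSum S T m m' (choice S T prior c ω) j}
      ≤ ENNReal.ofReal (Real.exp (-(t ^ 2 / (4 * K * a)))) := fun j hj =>
    (hK _ (nonanticipating_choice S T prior c) m' j a t ha (le_trans (by
      have := Finset.mem_range.1 hj
      exact_mod_cast Nat.lt_succ_iff.1 this) hna) ht).1
  have hsub : {ω | N S T prior c ω ≤ n} ⊆
      (({ω | (k : ℕ∞) < N₀ S T prior c ω} ∪ {ω | D₀ S T prior c ω ≠ m}) ∪
        {ω | D S T prior c ω ≠ m}) ∪
      ({ω | ¬ RegularPath S ω} ∪ ⋃ j ∈ Finset.range (n + 1),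
        {ω | t ≤ llrSum S T m m' (choice S T prior c ω) ω j -
          driftSum S T m m' (choice S T prior c ω) j}) := by
    intro ω hω
    by_cases hN : (k : ℕ∞) < N₀ S T prior c ω
    · exact Or.inl (Or.inl (Or.inl hN))
    by_cases hD₀ : D₀ S T prior c ω ≠ m
    · exact Or.inl (Or.inl (Or.inr hD₀))
    by_cases hD : D S T prior c ω ≠ m
    · exact Or.inl (Or.inr hD)
    by_cases hreg : RegularPath S ω
    swap
    · exact Or.inr (Or.inl hreg)
    right; right
    rw [not_lt] at hN
    rw [not_not] at hD hD₀
    simp only [Set.mem_ofPred_eq] at hω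
    have hp := le_posterior_D (ne_top_of_le_ne_top (ENat.natCast_ne_top n) hω)
    rw [hD, posterior_eq] at hp
    have hj : (N S T prior c ω).toNat ≤ n := ENat.toNat_le_of_le_natCast hω
    set j := (N S T prior c ω).toNat
    have hl := le_llrSum_of_le_postOf hreg hprior hsum hΔ hc2 hm' hp
    have hd : driftSum S T m m' (choice S T prior c ω) j ≤ k * B + a * I := by
      calc _ ≤ ∑ i ∈ Finset.range j, ((if i < k then B else 0) + I) := by
            refine Finset.sum_le_sum fun i _ => ?_
            split_ifs with h
            · linarith [hdrift (choice S T prior c ω i)]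
            · rw [choice_of_le hN (not_lt.1 h), hD₀, zero_add, hdriftI]
        _ ≤ k * B + j * I := by
            rw [Finset.sum_add_distrib]
            simpa using sum_range_ite_lt_le (k := k) hB0 j
        _ ≤ k * B + a * I := by
            gcongr
            exact le_trans (by exact_mod_cast hj) hna
    refine Set.mem_biUnion (x := j) (Finset.mem_coe.2 (Finset.mem_range.2 (by omega))) ?_
    simp only [Set.mem_ofPred_eq]
    linarith
  refine (measure_mono hsub).trans ((measure_union_le _ _).trans ?_)
  gcongr
  · refine (measure_union_le _ _).trans ?_
    gcongr
    exact measure_union_le _ _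
  calc _ ≤ S.pathMeasure T m {ω | ¬ RegularPath S ω} + ∑ j ∈ Finset.range (n + 1),
        S.pathMeasure T m {ω | t ≤ llrSum S T m m' (choice S T prior c ω) ω j -
          driftSum S T m m' (choice S T prior c ω) j} :=
      (measure_union_le _ _).trans (by gcongr; exact measure_biUnion_finset_le _ _)
    _ ≤ 0 + ∑ _j ∈ Finset.range (n + 1), ENNReal.ofReal (Real.exp (-(t ^ 2 / (4 * K * a)))) :=
      add_le_add (ae_iff.1 (ae_regularPath hS T m)).le (Finset.sum_le_sum hdev)
    _ = _ := by
      rw [zero_add, Finset.sum_const, Finset.card_range, nsmul_eq_mul,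
        ENNReal.ofReal_mul (by positivity)]
      congr 1
      rw [← Nat.cast_succ, ENNReal.ofReal_natCast]

end Bounds

end TwoStage

end

noncomputable section

namespace TwoStage

variable {𝒳 : Type*} [MeasurableSpace 𝒳] {M l : ℕ}

/-- The standing assumptions on the model, the design and the prior. -/
structure Admissible (S : Model 𝒳 M) (T : Design 𝒳 M l) (prior : Fin M → ℝ) : Prop where
  two_le : 2 ≤ M
  finiteDivergence : S.FiniteDivergence
  validFirstStage : ValidFirstStage S T
  prior_pos : ∀ m, 0 < prior m
  sum_prior : ∑ m, prior m = 1
  minInfo_pos : ∀ m m', 0 < S.minInfo (T.second m') m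

theorem minInfo_le (S : Model 𝒳 M)
    (ψ : RandQuantizer 𝒳 l) {m m' : Fin M} (h : m' ≠ m) : S.minInfo ψ m ≤ S.randInfo ψ m m' :=
  ciInf_le (f := fun m' : {m' : Fin M // m' ≠ m} => S.randInfo ψ m m'.1)
    (Set.finite_range _).bddBelow ⟨m', h⟩

theorem exists_randInfo_eq_minInfo (hM : 2 ≤ M)
    (S : Model 𝒳 M) (ψ : RandQuantizer 𝒳 l) (m : Fin M) :
    ∃ m' ≠ m, S.randInfo ψ m m' = S.minInfo ψ m := by
  have : Nontrivial (Fin M) := Fin.nontrivial_iff_two_le.2 hM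
  obtain ⟨m₁, hm₁⟩ := exists_ne m
  have : Nonempty {m' : Fin M // m' ≠ m} := ⟨⟨m₁, hm₁⟩⟩
  obtain ⟨⟨m', hm'⟩, h⟩ := exists_eq_ciInf_of_finite
    (f := fun m' : {m' : Fin M // m' ≠ m} => S.randInfo ψ m m'.1)
  exact ⟨m', hm', h⟩

theorem tendsto_neg_log_nhdsGT_zero :
    Tendsto (fun c : ℝ => -Real.log c) (𝓝[>] 0) atTop :=
  tendsto_neg_atBot_atTop.comp Real.tendsto_log_nhdsGT_zero

theorem eventually_le_mul_neg_log {ε : ℝ} (hε : 0 < ε) (C : ℝ) :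
    ∀ᶠ c : ℝ in 𝓝[>] 0, C ≤ ε * -Real.log c :=
  (tendsto_neg_log_nhdsGT_zero.const_mul_atTop hε).eventually_ge_atTop C

theorem eventually_mem_Ioc_nhdsGT_zero {b : ℝ} (hb : 0 < b) :
    ∀ᶠ c : ℝ in 𝓝[>] 0, 0 < c ∧ c ≤ b :=
  Ioc_mem_nhdsGT hb

/-- `(A L + B) exp (-κ L) → 0` for `L = -log c`. -/
theorem tendsto_ofReal_mul_exp_neg (A B : ℝ) {κ : ℝ} (hκ : 0 < κ) :
    Tendsto (fun c : ℝ => ENNReal.ofReal ((A * -Real.log c + B) * Real.exp (-(κ * -Real.log c))))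
      (𝓝[>] 0) (𝓝 0) := by
  rw [← ENNReal.ofReal_zero]
  refine ENNReal.tendsto_ofReal ?_
  have h : Tendsto (fun L : ℝ => (A * L + B) * Real.exp (-(κ * L))) atTop (𝓝 0) := by
    have h1 := (tendsto_id.const_mul_atTop hκ : Tendsto (fun L : ℝ => κ * L) atTop atTop)
    have h2 := (Real.tendsto_pow_mul_exp_neg_atTop_nhds_zero 1).comp h1
    have h3 := (Real.tendsto_pow_mul_exp_neg_atTop_nhds_zero 0).comp h1
    have h4 := (h2.const_mul (A / κ)).add (h3.const_mul B)
    simp only [mul_zero, add_zero] at h4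
    refine h4.congr fun L => ?_
    simp only [Function.comp_apply]
    field_simp
  exact h.comp tendsto_neg_log_nhdsGT_zero

theorem toENNReal_eq_tsum (N : ℕ∞) :
    (N : ℝ≥0∞) = ∑' n : ℕ, if (n : ℕ∞) < N then (1 : ℝ≥0∞) else 0 := by
  induction N using ENat.recTopCoe with
  | top => simp
  | coe j =>
    rw [tsum_eq_sum (s := Finset.range j) fun n hn => by
      have : ¬ n < j := by simpa using hn
      simp [this], Finset.sum_congr rfl (g := fun _ => (1 : ℝ≥0∞)) fun n hn => by
      have : n < j := by simpa using hn
      simp [this]]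
    simp

theorem expN_eq_tsum [NeZero M] (S : Model 𝒳 M) (T : Design 𝒳 M l) (prior : Fin M → ℝ) (c : ℝ)
    (m : Fin M) : expN S T prior c m = ∑' n : ℕ, S.pathMeasure T m {ω | (n : ℕ∞) < N S T prior c ω} := by
  have hmeas : ∀ n : ℕ, MeasurableSet {ω : Path T | (n : ℕ∞) < N S T prior c ω} := fun n => by
    have := (measurableSet_N_le S T prior c n).compl
    simpa only [Set.compl_ofPred, not_le] using this
  simp only [expN, toENNReal_eq_tsum]
  rw [lintegral_tsum]
  · refine tsum_congr fun n => ?_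
    rw [← lintegral_indicator_one (hmeas n)]
    exact lintegral_congr fun ω => by simp [Set.indicator_apply]
  · exact fun n => (measurable_const.ite (hmeas n) measurable_const).aemeasurable

namespace Admissible

variable {S : Model 𝒳 M} {T : Design 𝒳 M l} {prior : Fin M → ℝ}

theorem drift_pos (h : Admissible S T prior) {m m' : Fin M} (hm : m' ≠ m) :
    ∀ s, 0 < S.drift T m m' s
  | none => h.validFirstStage.info_pos m m' hm.symm
  | some d => (h.minInfo_pos m d).trans_le (minInfo_le S _ hm)

theorem exists_drift_ge (h : Admissible S T prior) (m : Fin M) :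
    ∃ μ₀ : ℝ, 0 < μ₀ ∧ ∀ m' ≠ m, ∀ s, μ₀ ≤ S.drift T m m' s := by
  obtain ⟨m₁, hm₁, -⟩ := exists_randInfo_eq_minInfo h.two_le S (T.second m) m
  have : Nonempty ({m' : Fin M // m' ≠ m} × Option (Fin M)) := ⟨⟨⟨m₁, hm₁⟩, none⟩⟩
  obtain ⟨p, hp⟩ := Finite.exists_min
    fun p : {m' : Fin M // m' ≠ m} × Option (Fin M) => S.drift T m p.1.1 p.2
  exact ⟨_, h.drift_pos p.1.2 p.2, fun m' hm' s => hp ⟨⟨m', hm'⟩, s⟩⟩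

theorem eventually_neg_log_u_le (h : Admissible S T prior) {ε : ℝ} (hε : 0 < ε) :
    ∀ᶠ c in 𝓝[>] (0 : ℝ), -Real.log (T.u c) ≤ ε * -Real.log c := by
  filter_upwards [h.validFirstStage.log_u.eventually_lt_const hε,
    eventually_le_mul_neg_log one_pos 1] with c hc hL
  rw [div_lt_iff_of_neg (by linarith)] at hc
  linarith

variable [NeZero M]

/-- Exponential tails of the duration of the test, starting at a multiple of `|log c|`. -/
theorem exists_eventually_measure_lt_N_le (h : Admissible S T prior) (m : Fin M) :
    ∃ γ C : ℝ, 0 < γ ∧ 0 < C ∧ ∀ᶠ c in 𝓝[>] (0 : ℝ), ∀ n : ℕ, C * -Real.log c ≤ n →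
      S.pathMeasure T m {ω | (n : ℕ∞) < N S T prior c ω}
        ≤ ENNReal.ofReal (2 * M * Real.exp (-(γ * n))) := by
  obtain ⟨Δ, hΔ0, hΔ⟩ := exists_prior_bound prior
  obtain ⟨μ₀, hμ₀, hdrift⟩ := h.exists_drift_ge m
  obtain ⟨γ, hγ0, hγ⟩ := exists_measure_lt_N_le T h.finiteDivergence h.prior_pos h.sum_prior hΔ
    hμ₀ hdrift
  refine ⟨γ, 4 / μ₀, hγ0, by positivity, ?_⟩
  filter_upwards [h.validFirstStage.u_mem, h.eventually_neg_log_u_le one_pos,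
    eventually_le_mul_neg_log one_pos (Δ + Real.log M), eventually_mem_Ioc_nhdsGT_zero one_pos]
    with c hu hV hL hc n hn
  have hn' : 4 * -Real.log c ≤ μ₀ * n := by
    rw [div_mul_eq_mul_div, div_le_iff₀ hμ₀] at hn
    linarith
  exact (hγ c n hu.1 (by linarith)).2 hc.1 (by linarith)

theorem eventually_measure_N_eq_top (h : Admissible S T prior) (m : Fin M) :
    ∀ᶠ c in 𝓝[>] (0 : ℝ), S.pathMeasure T m {ω | N S T prior c ω = ⊤} = 0 := by
  obtain ⟨γ, C, hγ, hC, hev⟩ := h.exists_eventually_measure_lt_N_le m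
  filter_upwards [hev] with c hc
  have hlim : Tendsto (fun n : ℕ => ENNReal.ofReal (2 * M * Real.exp (-(γ * n)))) atTop (𝓝 0) := by
    rw [← ENNReal.ofReal_zero]
    refine ENNReal.tendsto_ofReal ?_
    rw [← mul_zero (2 * (M : ℝ))]
    exact (Real.tendsto_exp_neg_atTop_nhds_zero.comp
      (tendsto_natCast_atTop_atTop.const_mul_atTop hγ)).const_mul _
  refine le_antisymm (ge_of_tendsto hlim ?_) zero_le
  filter_upwards [eventually_ge_atTop ⌈C * -Real.log c⌉₊] with n hn
  refine (measure_mono fun ω hω => ?_).trans (hc n ((Nat.le_ceil _).trans (by exact_mod_cast hn)))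
  simp only [Set.mem_ofPred_eq] at hω ⊢
  rw [hω]; exact ENat.natCast_lt_top n

theorem N₀_le_N (S : Model 𝒳 M) (T : Design 𝒳 M l) (prior : Fin M → ℝ) (c : ℝ) (ω : Path T) :
    N₀ S T prior c ω ≤ N S T prior c ω :=
  le_iInf₂ fun _ hn => hn.1

theorem tendsto_measure_D₀_ne (h : Admissible S T prior) (m : Fin M) :
    Tendsto (fun c => S.pathMeasure T m {ω | D₀ S T prior c ω ≠ m}) (𝓝[>] 0) (𝓝 0) := by
  obtain ⟨Δ, hΔ0, hΔ⟩ := exists_prior_bound prior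
  have hlim : Tendsto (fun c => ENNReal.ofReal (M * (2 * Real.exp Δ) * T.u c)) (𝓝[>] 0) (𝓝 0) := by
    rw [← ENNReal.ofReal_zero]
    refine ENNReal.tendsto_ofReal ?_
    simpa using h.validFirstStage.u_tendsto.const_mul ((M : ℝ) * (2 * Real.exp Δ))
  refine tendsto_of_tendsto_of_tendsto_of_le_of_le' tendsto_const_nhds hlim
    (Eventually.of_forall fun _ => zero_le) ?_
  filter_upwards [h.validFirstStage.u_mem, h.eventually_measure_N_eq_top m] with c hu hN
  refine measure_D₀_ne_le h.finiteDivergence h.prior_pos h.sum_prior hΔ hu.1 hu.2.le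
    (measure_mono_null (fun ω hω => ?_) hN)
  simp only [Set.mem_ofPred_eq] at hω ⊢
  exact top_le_iff.1 (hω ▸ N₀_le_N S T prior c ω)

theorem exists_eventually_measure_D_ne_le (h : Admissible S T prior) (m : Fin M) :
    ∃ C : ℝ, 0 ≤ C ∧ ∀ᶠ c in 𝓝[>] (0 : ℝ),
      S.pathMeasure T m {ω | D S T prior c ω ≠ m} ≤ ENNReal.ofReal (C * c) := by
  obtain ⟨Δ, hΔ0, hΔ⟩ := exists_prior_bound prior
  refine ⟨M * (2 * Real.exp Δ), by positivity, ?_⟩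
  filter_upwards [eventually_mem_Ioc_nhdsGT_zero (b := 1 / 2) (by norm_num),
    h.eventually_measure_N_eq_top m] with c hc hN
  exact measure_D_ne_le h.finiteDivergence h.prior_pos h.sum_prior hΔ hc.1 hc.2 hN

theorem tendsto_measure_D_ne (h : Admissible S T prior) (m : Fin M) :
    Tendsto (fun c => S.pathMeasure T m {ω | D S T prior c ω ≠ m}) (𝓝[>] 0) (𝓝 0) := by
  obtain ⟨C, -, hev⟩ := h.exists_eventually_measure_D_ne_le m
  have hlim : Tendsto (fun c : ℝ => ENNReal.ofReal (C * c)) (𝓝[>] 0) (𝓝 0) := by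
    rw [← ENNReal.ofReal_zero]
    refine ENNReal.tendsto_ofReal ?_
    conv => rhs; rw [← mul_zero C]
    exact (tendsto_nhdsWithin_of_tendsto_nhds tendsto_id).const_mul C
  exact tendsto_of_tendsto_of_tendsto_of_le_of_le' tendsto_const_nhds hlim
    (Eventually.of_forall fun _ => zero_le) hev

theorem tendsto_measure_lt_N₀ (h : Admissible S T prior) (m : Fin M) {δ : ℝ} (hδ : 0 < δ) :
    Tendsto (fun c => S.pathMeasure T m
      {ω | ((⌈δ * -Real.log c⌉₊ : ℕ) : ℕ∞) < N₀ S T prior c ω}) (𝓝[>] 0) (𝓝 0) := by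
  obtain ⟨Δ, hΔ0, hΔ⟩ := exists_prior_bound prior
  obtain ⟨μ₀, hμ₀, hdrift⟩ := h.exists_drift_ge m
  obtain ⟨γ, hγ0, hγ⟩ := exists_measure_lt_N_le T h.finiteDivergence h.prior_pos h.sum_prior hΔ
    hμ₀ hdrift
  refine tendsto_of_tendsto_of_tendsto_of_le_of_le' tendsto_const_nhds
    (tendsto_ofReal_mul_exp_neg 0 M (mul_pos hγ0 hδ)) (Eventually.of_forall fun _ => zero_le) ?_
  have hε : 0 < μ₀ * δ / 4 := by positivity
  filter_upwards [h.validFirstStage.u_mem, h.eventually_neg_log_u_le hε,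
    eventually_le_mul_neg_log hε (Δ + Real.log M)] with c hu hV hL
  have hk := Nat.le_ceil (δ * -Real.log c)
  have hk' := mul_le_mul_of_nonneg_left hk hμ₀.le
  have hk'' := mul_le_mul_of_nonneg_left hk hγ0.le
  refine (hγ c _ hu.1 (by linarith)).1.trans (ENNReal.ofReal_le_ofReal ?_)
  rw [zero_mul, zero_add]
  exact mul_le_mul_of_nonneg_left (Real.exp_le_exp.2 (by linarith)) M.cast_nonneg

theorem tendsto_measure_lt_N (h : Admissible S T prior) (m : Fin M) {η : ℝ} (hη : 0 < η) :
    Tendsto (fun c => S.pathMeasure T m {ω |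
      ((⌈(1 / S.minInfo (T.second m) m + η) * -Real.log c⌉₊ : ℕ) : ℕ∞) < N S T prior c ω})
      (𝓝[>] 0) (𝓝 0) := by
  obtain ⟨Δ, hΔ0, hΔ⟩ := exists_prior_bound prior
  set I := S.minInfo (T.second m) m with hIdef
  have hI : 0 < I := h.minInfo_pos m m
  obtain ⟨K, hK0, hK⟩ := exists_measure_lt_N_le_add T h.finiteDivergence h.prior_pos h.sum_prior hΔ
    hI.le (fun m' hm' s => (h.drift_pos hm' s).le) (fun m' hm' => minInfo_le S (T.second m) hm')
  set κ : ℝ := (η * I / 2) ^ 2 / (4 * K * (1 / I + η + 1)) with hκ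
  have hκ0 : 0 < κ := by positivity
  have hlim := ((h.tendsto_measure_lt_N₀ m (δ := η / 4) (by positivity)).add
    (h.tendsto_measure_D₀_ne m)).add (tendsto_ofReal_mul_exp_neg 0 M hκ0)
  simp only [add_zero] at hlim
  refine tendsto_of_tendsto_of_tendsto_of_le_of_le' tendsto_const_nhds hlim
    (Eventually.of_forall fun _ => zero_le) ?_
  filter_upwards [eventually_mem_Ioc_nhdsGT_zero one_pos, eventually_le_mul_neg_log one_pos 1,
    eventually_le_mul_neg_log (ε := η * I / 4) (by positivity) (I + Δ + Real.log M)] with c hc hL1 hL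
  rw [one_mul] at hL1
  set L := -Real.log c with hLdef
  have hL0 : 0 < L := by linarith
  have hn1 := Nat.le_ceil ((1 / I + η) * L)
  have hn2 := Nat.ceil_lt_add_one (a := (1 / I + η) * L) (by positivity)
  have hk2 := Nat.ceil_lt_add_one (a := η / 4 * L) (by positivity)
  refine (hK c ⌈η / 4 * L⌉₊ _ ((1 / I + η + 1) * L) (η * I / 2 * L) hc.1 ?_ (by positivity) ?_
    (by positivity) ?_).trans ?_
  · refine Nat.ceil_mono ?_
    have : 0 < 1 / I * L := by positivity
    nlinarith
  · linarith
  · have h1 : ((1 / I + η) * L - (η / 4 * L + 1)) * I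
        ≤ ((⌈(1 / I + η) * L⌉₊ : ℝ) - ⌈η / 4 * L⌉₊) * I := by gcongr
    have h2 : ((1 / I + η) * L - (η / 4 * L + 1)) * I = L + 3 / 4 * (η * I) * L - I := by
      field_simp; ring
    linarith
  · have hexp : (η * I / 2 * L) ^ 2 / (4 * K * ((1 / I + η + 1) * L)) = κ * L := by
      rw [hκ]; field_simp
    rw [hexp, zero_mul, zero_add]

theorem tendsto_measure_N_le (h : Admissible S T prior) (m : Fin M) {η : ℝ} (hη : 0 < η)
    (hη' : η < 1 / S.minInfo (T.second m) m) :
    Tendsto (fun c => S.pathMeasure T m {ω | N S T prior c ω ≤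
      ((⌊(1 / S.minInfo (T.second m) m - η) * -Real.log c⌋₊ : ℕ) : ℕ∞)}) (𝓝[>] 0) (𝓝 0) := by
  obtain ⟨Δ, hΔ0, hΔ⟩ := exists_prior_bound prior
  obtain ⟨m', hm', hmin⟩ := exists_randInfo_eq_minInfo h.two_le S (T.second m) m
  set I := S.minInfo (T.second m) m with hIdef
  have hI : 0 < I := h.minInfo_pos m m
  obtain ⟨B, hB⟩ := (Set.finite_range (S.drift T m m')).bddAbove
  have hB' : ∀ s, S.drift T m m' s ≤ B := fun s => hB ⟨s, rfl⟩
  have hB0 : 0 < B := (h.drift_pos hm' none).trans_le (hB' none)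
  obtain ⟨K, hK0, hK⟩ := exists_measure_N_le_le_add T h.finiteDivergence h.prior_pos h.sum_prior hΔ
    hI.le hB0.le hm' hB' hmin
  have hα : 0 < 1 / I - η := by linarith
  set κ : ℝ := (η * I / 2) ^ 2 / (4 * K * (1 / I - η)) with hκ
  have hκ0 : 0 < κ := by positivity
  have hδ : 0 < η * I / (4 * B) := by positivity
  have hlim := (((h.tendsto_measure_lt_N₀ m hδ).add (h.tendsto_measure_D₀_ne m)).add
    (h.tendsto_measure_D_ne m)).add (tendsto_ofReal_mul_exp_neg (1 / I - η) 1 hκ0)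
  simp only [add_zero] at hlim
  refine tendsto_of_tendsto_of_tendsto_of_le_of_le' tendsto_const_nhds hlim
    (Eventually.of_forall fun _ => zero_le) ?_
  filter_upwards [eventually_mem_Ioc_nhdsGT_zero (b := 1 / 2) (by norm_num),
    eventually_le_mul_neg_log one_pos 1,
    eventually_le_mul_neg_log (ε := η * I / 4) (by positivity) (B + Δ + Real.log 2)]
    with c hc hL1 hL
  rw [one_mul] at hL1
  set L := -Real.log c with hLdef
  have hL0 : 0 < L := by linarith
  have hn := Nat.floor_le (a := (1 / I - η) * L) (by positivity)
  have hk := Nat.ceil_lt_add_one (a := η * I / (4 * B) * L) (by positivity)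
  refine (hK c ⌈η * I / (4 * B) * L⌉₊ _ ((1 / I - η) * L) (η * I / 2 * L) hc.2 (by positivity) hn
    (by positivity) ?_).trans ?_
  · have h1 : (⌈η * I / (4 * B) * L⌉₊ : ℝ) * B ≤ (η * I / (4 * B) * L + 1) * B := by gcongr
    have h2 : (η * I / (4 * B) * L + 1) * B = η * I / 4 * L + B := by field_simp
    have h3 : (1 / I - η) * L * I = L - η * I * L := by field_simp
    linarith
  · have hexp : (η * I / 2 * L) ^ 2 / (4 * K * ((1 / I - η) * L)) = κ * L := by
      rw [hκ]; field_simp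
    rw [hexp]
    gcongr

end Admissible

end TwoStage

end

noncomputable section

namespace TwoStage

namespace Admissible

variable {𝒳 : Type*} [MeasurableSpace 𝒳] {M l : ℕ} [NeZero M] {S : Model 𝒳 M} {T : Design 𝒳 M l}
  {prior : Fin M → ℝ}

theorem eventually_expN_le (h : Admissible S T prior) (m : Fin M) {η : ℝ} (hη : 0 < η) :
    ∀ᶠ c in 𝓝[>] (0 : ℝ), expN S T prior c m
      ≤ ENNReal.ofReal ((1 / S.minInfo (T.second m) m + 2 * η) * -Real.log c) := by
  obtain ⟨γ, C, hγ, hC, htail⟩ := h.exists_eventually_measure_lt_N_le m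
  have hlim := h.tendsto_measure_lt_N m hη
  set I := S.minInfo (T.second m) m
  have hI : 0 < I := h.minInfo_pos m m
  have hsummable : Summable fun n : ℕ => 2 * (M : ℝ) * Real.exp (-(γ * n)) := by
    refine Summable.mul_left _ ?_
    simpa [mul_comm] using Real.summable_exp_nat_mul_iff.2 (neg_lt_zero.2 hγ)
  set C' := ∑' n : ℕ, 2 * (M : ℝ) * Real.exp (-(γ * n)) with hC'
  have hC'0 : 0 ≤ C' := tsum_nonneg fun n => by positivity
  have hε : 0 < η / (2 * (C + 1)) := by positivity
  filter_upwards [htail, hlim.eventually_le_const (ENNReal.ofReal_pos.2 hε),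
    eventually_le_mul_neg_log one_pos 1,
    eventually_le_mul_neg_log (ε := η / 2) (by positivity) (1 + C')] with c htail hq hL1 hL
  rw [one_mul] at hL1
  set L := -Real.log c with hLdef
  have hL0 : 0 < L := by linarith
  set n₁ := ⌈(1 / I + η) * L⌉₊
  set n₂ := ⌈C * L⌉₊
  have hn₁ : (n₁ : ℝ) < (1 / I + η) * L + 1 := Nat.ceil_lt_add_one (by positivity)
  have hn₂ : (n₂ : ℝ) < C * L + 1 := Nat.ceil_lt_add_one (by positivity)
  have hterm : ∀ n : ℕ, S.pathMeasure T m {ω | (n : ℕ∞) < N S T prior c ω} ≤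
      ((if n < n₁ then 1 else 0) +
        (if n < n₂ then ENNReal.ofReal (η / (2 * (C + 1))) else 0)) +
        ENNReal.ofReal (2 * M * Real.exp (-(γ * n))) := by
    intro n
    by_cases h1 : n < n₁
    · rw [if_pos h1]
      exact prob_le_one.trans (le_add_right (le_add_right le_rfl))
    by_cases h2 : n < n₂
    · rw [if_pos h2]
      refine le_add_right (le_add_left ((measure_mono fun ω hω => ?_).trans hq))
      have hle : (n₁ : ℕ∞) ≤ n := by exact_mod_cast not_lt.1 h1
      exact hle.trans_lt hω
    · exact le_add_left (htail n ((Nat.le_ceil _).trans (by exact_mod_cast not_lt.1 h2)))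
  have hite : ∀ (k : ℕ) (b : ℝ≥0∞), ∑' n : ℕ, (if n < k then b else 0) = k * b := fun k b => by
    rw [tsum_eq_sum (s := Finset.range k) fun n hn => by
      rw [if_neg (by simpa using hn)], Finset.sum_congr rfl fun n hn => by
      rw [if_pos (by simpa using hn)], Finset.sum_const, Finset.card_range, nsmul_eq_mul]
  rw [expN_eq_tsum]
  calc _ ≤ _ := ENNReal.tsum_le_tsum hterm
    _ = n₁ + n₂ * ENNReal.ofReal (η / (2 * (C + 1))) + ENNReal.ofReal C' := by
      rw [ENNReal.tsum_add, ENNReal.tsum_add, hite, hite, mul_one, hC',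
        ENNReal.ofReal_tsum_of_nonneg (fun n => by positivity) hsummable]
    _ = ENNReal.ofReal (n₁ + n₂ * (η / (2 * (C + 1))) + C') := by
      rw [ENNReal.ofReal_add (by positivity) hC'0, ENNReal.ofReal_add (by positivity)
        (by positivity), ENNReal.ofReal_mul (by positivity), ENNReal.ofReal_natCast,
        ENNReal.ofReal_natCast]
    _ ≤ _ := by
      refine ENNReal.ofReal_le_ofReal ?_
      have h1 : (n₂ : ℝ) * (η / (2 * (C + 1))) ≤ (C + 1) * L * (η / (2 * (C + 1))) := by
        gcongr; linarith
      have h2 : (C + 1) * L * (η / (2 * (C + 1))) = η / 2 * L := by field_simp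
      linarith

theorem eventually_le_expN (h : Admissible S T prior) (m : Fin M) {η : ℝ} (hη : 0 < η) :
    ∀ᶠ c in 𝓝[>] (0 : ℝ), ENNReal.ofReal ((1 / S.minInfo (T.second m) m - 2 * η) * -Real.log c)
      ≤ expN S T prior c m := by
  have hI : 0 < S.minInfo (T.second m) m := h.minInfo_pos m m
  rcases le_or_gt (1 / S.minInfo (T.second m) m) η with hle | hlt
  · filter_upwards [eventually_le_mul_neg_log one_pos 1] with c hL
    rw [ENNReal.ofReal_of_nonpos]
    · exact zero_le
    · exact mul_nonpos_of_nonpos_of_nonneg (by linarith) (by linarith)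
  have hlim := h.tendsto_measure_N_le m hη hlt
  set I := S.minInfo (T.second m) m
  have hε : 0 < η * I := by positivity
  have hε1 : η * I < 1 := by rwa [lt_div_iff₀ hI] at hlt
  filter_upwards [hlim.eventually_le_const (ENNReal.ofReal_pos.2 hε),
    eventually_le_mul_neg_log one_pos 1] with c hq hL1
  rw [one_mul] at hL1
  set L := -Real.log c with hLdef
  have hL0 : 0 < L := by linarith
  have ha0 : 0 ≤ (1 / I - η) * L := mul_nonneg (by linarith) hL0.le
  set n := ⌊(1 / I - η) * L⌋₊
  have hn : (1 / I - η) * L < n + 1 := Nat.lt_floor_add_one _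
  have hmeas := measurableSet_N_le S T prior c n
  calc _ ≤ ENNReal.ofReal ((1 / I - η) * L * (1 - η * I)) := by
        refine ENNReal.ofReal_le_ofReal ?_
        have h1 : (1 / I - η) * L * (1 - η * I) = (1 / I - 2 * η) * L + η ^ 2 * I * L := by
          field_simp; ring
        have : 0 ≤ η ^ 2 * I * L := by positivity
        linarith
    _ = ENNReal.ofReal ((1 / I - η) * L) * (1 - ENNReal.ofReal (η * I)) := by
        rw [ENNReal.ofReal_mul ha0, ENNReal.ofReal_sub _ hε.le, ENNReal.ofReal_one]
    _ ≤ ENNReal.ofReal ((1 / I - η) * L) *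
          S.pathMeasure T m {ω : Path T | N S T prior c ω ≤ n}ᶜ := by
        rw [prob_compl_eq_one_sub hmeas]
        gcongr
    _ = ∫⁻ ω, ({ω : Path T | N S T prior c ω ≤ n}ᶜ).indicator
          (fun _ => ENNReal.ofReal ((1 / I - η) * L)) ω ∂S.pathMeasure T m :=
        (lintegral_indicator_const hmeas.compl _).symm
    _ ≤ _ := by
        refine lintegral_mono fun ω => ?_
        by_cases hω : N S T prior c ω ≤ n
        · simp [hω]
        · rw [Set.indicator_of_mem (by simpa using hω)]
          have h1 : ((n + 1 : ℕ) : ℕ∞) ≤ N S T prior c ω := by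
            push_cast; exact Order.add_one_le_of_lt (not_le.1 hω)
          calc ENNReal.ofReal ((1 / I - η) * L) ≤ ENNReal.ofReal ((n + 1 : ℕ) : ℝ) :=
                ENNReal.ofReal_le_ofReal (by push_cast; exact hn.le)
            _ = (((n + 1 : ℕ) : ℕ∞) : ℝ≥0∞) := by rw [ENNReal.ofReal_natCast]; simp
            _ ≤ _ := by exact_mod_cast h1

theorem eventually_expN_ne_top (h : Admissible S T prior) (m : Fin M) :
    ∀ᶠ c in 𝓝[>] (0 : ℝ), expN S T prior c m ≠ ⊤ :=
  (h.eventually_expN_le m one_pos).mono fun _ hc => ne_top_of_le_ne_top ENNReal.ofReal_ne_top hc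

theorem tendsto_expN_div (h : Admissible S T prior) (m : Fin M) :
    Tendsto (fun c => (expN S T prior c m).toReal / -Real.log c) (𝓝[>] 0)
      (𝓝 (1 / S.minInfo (T.second m) m)) := by
  have hI : 0 < S.minInfo (T.second m) m := h.minInfo_pos m m
  refine Metric.tendsto_nhds.2 fun ε hε => ?_
  filter_upwards [h.eventually_expN_le m (η := ε / 3) (by positivity),
    h.eventually_le_expN m (η := ε / 3) (by positivity), h.eventually_expN_ne_top m,
    eventually_le_mul_neg_log one_pos 1] with c h1 h2 htop hL
  have hL0 : 0 < -Real.log c := by linarith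
  have h1' := ENNReal.toReal_le_of_le_ofReal (by positivity) h1
  have h2' := (ENNReal.ofReal_le_iff_le_toReal htop).1 h2
  rw [Real.dist_eq, abs_lt]
  rw [← div_le_iff₀ hL0] at h1'
  rw [← le_div_iff₀ hL0] at h2'
  constructor <;> linarith

theorem isEquivalent_expN (h : Admissible S T prior) (m : Fin M) :
    (fun c => (expN S T prior c m).toReal)
      ~[𝓝[>] (0 : ℝ)] fun c => |Real.log c| / S.minInfo (T.second m) m := by
  have hI : 0 < S.minInfo (T.second m) m := h.minInfo_pos m m
  have hL : ∀ᶠ c : ℝ in 𝓝[>] 0, 0 < -Real.log c :=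
    tendsto_neg_log_nhdsGT_zero.eventually_gt_atTop 0
  refine (isEquivalent_iff_tendsto_one (hL.mono fun c hc => ?_)).2 ?_
  · exact div_ne_zero (abs_ne_zero.2 fun h0 => by simp [h0] at hc) hI.ne'
  · have h1 := (h.tendsto_expN_div m).mul_const (S.minInfo (T.second m) m)
    rw [one_div, inv_mul_cancel₀ hI.ne'] at h1
    refine h1.congr' (hL.mono fun c hc => ?_)
    rw [Pi.div_apply, abs_of_neg (by linarith)]
    field_simp

theorem isBigO_measure_D_ne (h : Admissible S T prior) (m : Fin M) :
    (fun c => (S.pathMeasure T m).real {ω | D S T prior c ω ≠ m}) =O[𝓝[>] (0 : ℝ)] fun c => c := by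
  obtain ⟨C, hC, hev⟩ := h.exists_eventually_measure_D_ne_le m
  refine IsBigO.of_bound C ?_
  filter_upwards [hev, self_mem_nhdsWithin] with c hc hc0
  rw [Real.norm_of_nonneg measureReal_nonneg, Real.norm_of_nonneg (le_of_lt hc0)]
  exact ENNReal.toReal_le_of_le_ofReal (mul_nonneg hC (le_of_lt hc0)) hc

variable {W : Fin M → Fin M → ℝ}

theorem eventually_bayesRisk_ne_top (h : Admissible S T prior) :
    ∀ᶠ c in 𝓝[>] (0 : ℝ), bayesRisk S T prior W c ≠ ⊤ := by
  filter_upwards [eventually_all.2 fun m => h.eventually_expN_ne_top m] with c hc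
  refine ENNReal.sum_ne_top.2 fun m _ => ENNReal.mul_ne_top ENNReal.ofReal_ne_top
    (ENNReal.add_ne_top.2 ⟨ENNReal.mul_ne_top ENNReal.ofReal_ne_top (hc m),
      ENNReal.sum_ne_top.2 fun m' _ =>
        ENNReal.mul_ne_top ENNReal.ofReal_ne_top (measure_ne_top _ _)⟩)

theorem tendsto_bayesRisk_div (h : Admissible S T prior) (hW0 : ∀ m, W m m = 0) :
    Tendsto (fun c => (bayesRisk S T prior W c).toReal / (c * -Real.log c)) (𝓝[>] 0)
      (𝓝 (∑ m, prior m / S.minInfo (T.second m) m)) := by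
  have hL : ∀ᶠ c : ℝ in 𝓝[>] 0, 0 < -Real.log c :=
    tendsto_neg_log_nhdsGT_zero.eventually_gt_atTop 0
  have herr : ∀ m m', Tendsto (fun c => (ENNReal.ofReal (W m m')).toReal *
      (S.pathMeasure T m).real {ω | D S T prior c ω = m'} / (c * -Real.log c)) (𝓝[>] 0) (𝓝 0) := by
    intro m m'
    rcases eq_or_ne m m' with rfl | hne
    · simp [hW0]
    · have h1 : (fun c => (S.pathMeasure T m).real {ω | D S T prior c ω = m'})
          =O[𝓝[>] (0 : ℝ)] fun c => c := by
        refine (IsBigO.of_bound 1 (Eventually.of_forall fun c => ?_)).trans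
          (h.isBigO_measure_D_ne m)
        rw [one_mul, Real.norm_of_nonneg measureReal_nonneg, Real.norm_of_nonneg measureReal_nonneg]
        exact measureReal_mono fun ω (hω : D S T prior c ω = m') => hω.trans_ne hne.symm
      have h2 : (fun c : ℝ => c) =o[𝓝[>] (0 : ℝ)] fun c => c * -Real.log c := by
        have h3 : (fun _ : ℝ => (1 : ℝ)) =o[𝓝[>] (0 : ℝ)] fun c => -Real.log c :=
          isLittleO_const_left.2 (Or.inr
            (tendsto_norm_atTop_atTop.comp tendsto_neg_log_nhdsGT_zero))
        simpa using (isBigO_refl (fun c : ℝ => c) _).mul_isLittleO h3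
      exact ((h1.trans_isLittleO h2).const_mul_left _).tendsto_div_nhds_zero
  have hlim : Tendsto (fun c => ∑ m, prior m * ((expN S T prior c m).toReal / -Real.log c +
      ∑ m', (ENNReal.ofReal (W m m')).toReal *
        (S.pathMeasure T m).real {ω | D S T prior c ω = m'} / (c * -Real.log c))) (𝓝[>] 0)
      (𝓝 (∑ m, prior m * (1 / S.minInfo (T.second m) m + ∑ _m' : Fin M, 0))) :=
    tendsto_finsetSum _ fun m _ => ((h.tendsto_expN_div m).add
      (tendsto_finsetSum _ fun m' _ => herr m m')).const_mul _
  simp only [Finset.sum_const_zero, add_zero, mul_one_div] at hlim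
  refine hlim.congr' ?_
  filter_upwards [hL, self_mem_nhdsWithin, eventually_all.2 fun m => h.eventually_expN_ne_top m]
    with c hc hc0 htop
  have hc0' : 0 < c := hc0
  have hsum_top : ∀ m, ∑ m', ENNReal.ofReal (W m m') *
      S.pathMeasure T m {ω | D S T prior c ω = m'} ≠ ⊤ := fun m =>
    ENNReal.sum_ne_top.2 fun m' _ =>
      ENNReal.mul_ne_top ENNReal.ofReal_ne_top (measure_ne_top _ _)
  have hcE : ∀ m, ENNReal.ofReal c * expN S T prior c m ≠ ⊤ := fun m =>
    ENNReal.mul_ne_top ENNReal.ofReal_ne_top (htop m)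
  rw [bayesRisk, ENNReal.toReal_sum fun m _ => ENNReal.mul_ne_top ENNReal.ofReal_ne_top
    (ENNReal.add_ne_top.2 ⟨hcE m, hsum_top m⟩), Finset.sum_div]
  refine Finset.sum_congr rfl fun m _ => ?_
  rw [ENNReal.toReal_mul, ENNReal.toReal_ofReal (h.prior_pos m).le,
    ENNReal.toReal_add (hcE m) (hsum_top m), ENNReal.toReal_mul, ENNReal.toReal_ofReal hc0'.le,
    ENNReal.toReal_sum fun m' _ =>
      ENNReal.mul_ne_top ENNReal.ofReal_ne_top (measure_ne_top _ _), ← Finset.sum_div, mul_div_assoc,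
    add_div, mul_div_mul_left _ _ hc0'.ne']
  simp only [ENNReal.toReal_mul, measureReal_def]

theorem isEquivalent_bayesRisk (h : Admissible S T prior) (hW0 : ∀ m, W m m = 0) :
    (fun c => (bayesRisk S T prior W c).toReal) ~[𝓝[>] (0 : ℝ)]
      fun c => c * |Real.log c| * ∑ m, prior m / S.minInfo (T.second m) m := by
  have hpos : 0 < ∑ m, prior m / S.minInfo (T.second m) m :=
    Finset.sum_pos (fun m _ => div_pos (h.prior_pos m) (h.minInfo_pos m m)) ⟨0, Finset.mem_univ _⟩
  have hL : ∀ᶠ c : ℝ in 𝓝[>] 0, 0 < -Real.log c ∧ 0 < c :=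
    (tendsto_neg_log_nhdsGT_zero.eventually_gt_atTop 0).and self_mem_nhdsWithin
  refine (isEquivalent_iff_tendsto_one (hL.mono fun c hc => ?_)).2 ?_
  · exact mul_ne_zero (mul_ne_zero hc.2.ne'
      (abs_ne_zero.2 fun h0 => by simp [h0] at hc)) hpos.ne'
  · have h1 := (h.tendsto_bayesRisk_div hW0).div_const (∑ m, prior m / S.minInfo (T.second m) m)
    rw [div_self hpos.ne'] at h1
    refine h1.congr' (hL.mono fun c hc => ?_)
    rw [Pi.div_apply, abs_of_neg (by linarith), div_div]

end Admissible

end TwoStage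

end

theorem theorem4p1 {𝒳 : Type*} [MeasurableSpace 𝒳] {M l : ℕ} [NeZero M] (hM : 2 ≤ M)
    (S : TwoStage.Model 𝒳 M) (hS : S.FiniteDivergence)
    (T : TwoStage.Design 𝒳 M l) (hT : TwoStage.ValidFirstStage S T)
    (prior : Fin M → ℝ) (hprior : ∀ m, 0 < prior m) (hsum : ∑ m, prior m = 1)
    (W : Fin M → Fin M → ℝ) (hW0 : ∀ m, W m m = 0) (hW : ∀ m m', m ≠ m' → 0 < W m m')
    (hI : ∀ m m', 0 < S.minInfo (T.second m') m) :
    (∀ m, (∀ᶠ c in 𝓝[>] (0 : ℝ), TwoStage.expN S T prior c m ≠ ⊤) ∧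
      (fun c => (TwoStage.expN S T prior c m).toReal)
        ~[𝓝[>] (0 : ℝ)] fun c => |Real.log c| / S.minInfo (T.second m) m) ∧
    (∀ m, (fun c => (S.pathMeasure T m).real {ω | TwoStage.D S T prior c ω ≠ m})
        =O[𝓝[>] (0 : ℝ)] fun c => c) ∧
    (∀ᶠ c in 𝓝[>] (0 : ℝ), TwoStage.bayesRisk S T prior W c ≠ ⊤) ∧
    (fun c => (TwoStage.bayesRisk S T prior W c).toReal)
        ~[𝓝[>] (0 : ℝ)]
          fun c => c * |Real.log c| * ∑ m, prior m / S.minInfo (T.second m) m :=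
  have h : TwoStage.Admissible S T prior := ⟨hM, hS, hT, hprior, hsum, hI⟩
  ⟨fun m => ⟨h.eventually_expN_ne_top m, h.isEquivalent_expN m⟩, h.isBigO_measure_D_ne,
    h.eventually_bayesRisk_ne_top, h.isEquivalent_bayesRisk hW0⟩
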